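/- There is a universal constant $C$ such that the following holds. Let $G$ be a connected regular simple graph on a finite vertex set $V$ with $n=|V|\ge 6$ vertices, and let $\sigma_W,\sigma_B>0$. Let $(W_i)_{i\in V}$ be i.i.d. $\mathcal N(0,\sigma_W^2)$ random variables (well depths), and let $(B_{ij})$, indexed by the pairs of adjacent vertices, be random variables (barrier heights) with $B_{ij}=B_{ji}\sim\mathcal N(0,\sigma_B^2)$. Assume that $(W,B)$ is separable: there are a measurable $f:\mathbb R\to\mathbb R$ and $\sigma>0$ such that, for every $i\in V$, $(B_{ij}-f(W_i))_{j\sim i}$ is a vector of i.i.d. $\mathcal N(0,\sigma^2)$ random variables that is independent of $W_i$. Let $Q$ be the transition rate matrix of the continuous-time Markov chain on $V$ with rates $Q_{ij}=\exp(W_i-B_{ij})$ for $i\sim j$ and no other transitions, let $q_i=\sum_{j\sim i}Q_{ij}$ be its exit rates, and assume that almost surely there are $i,j$ with $q_i\ne q_j$. Let $\pi$ be the stationary distribution of $Q$ and, for each realization of $(W,B)$, let $$\rho=\operatorname{Corr}(-\log\pi_I,\log q_I)=\frac{\operatorname{Cov}(-\log \pi_I,\log q_I)}{\sqrt{\operatorname{Var}(\log\pi_I)\operatorname{Var}(\log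 q_I)}},$$ where $I$ is uniformly random on $V$, independent of $(W,B)$, and the (co)variances are over $I$ only. Then $\rho$ is almost surely well defined, integrable, and $$\mathbb E(\rho)\ \ge\ 1-8\bigl(1+C\,n^{-1/2}\bigr)\left(\frac{\sigma_B}{\sigma_W}\right)^2 .$$ In particular the bound does not depend on the degree of $G$. -/

import Mathlib

open MeasureTheory ProbabilityTheory
open scoped BigOperators Matrix

namespace Arrhenius

/-! ### Statistics of a uniformly random state

For `x : V → ℝ` and `I` uniformly distributed on the finite set `V`, these are the mean, covariance,
variance and correlation of the random variables `x_I`, `y_I`. -/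

/-- The mean of `x_I`, for `I` uniform on `V`. -/
noncomputable def unifMean {V : Type*} [Fintype V] (x : V → ℝ) : ℝ :=
  (∑ i, x i) / (Fintype.card V : ℝ)

/-- The covariance of `x_I` and `y_I`, for `I` uniform on `V`. -/
noncomputable def unifCov {V : Type*} [Fintype V] (x y : V → ℝ) : ℝ :=
  unifMean fun i => (x i - unifMean x) * (y i - unifMean y)

/-- The variance of `x_I`, for `I` uniform on `V`. -/
noncomputable def unifVar {V : Type*} [Fintype V] (x : V → ℝ) : ℝ :=
  unifCov x x

/-- The correlation of `x_I` and `y_I`, for `I` uniform on `V`. -/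
noncomputable def unifCorr {V : Type*} [Fintype V] (x y : V → ℝ) : ℝ :=
  unifCov x y / Real.sqrt (unifVar x * unifVar y)

/-! ### Continuous-time Markov chains on a finite set, given by their transition rate matrices -/

/-- The exit rate `q_i = ∑_{j ≠ i} Q_{ij}` of state `i`. -/
noncomputable def exitRate {V : Type*} [Fintype V] [DecidableEq V] (Q : Matrix V V ℝ) (i : V) : ℝ :=
  ∑ j ∈ Finset.univ.erase i, Q i j

/-- `p` is a stationary distribution of the chain with transition rate matrix `Q`: it is a
probability vector with `p Q = 0`. -/
structure IsStationary {V : Type*} [Fintype V] (Q : Matrix V V ℝ) (p : V → ℝ) : Prop where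
  nonneg : ∀ i, 0 ≤ p i
  sum_eq_one : ∑ i, p i = 1
  vecMul_eq_zero : p ᵥ* Q = 0

open Classical in
/-- The stationary distribution of the chain with transition rate matrix `Q`. It is only meaningful
when there is exactly one, as for irreducible chains. -/
noncomputable def stationaryDist {V : Type*} [Fintype V] (Q : Matrix V V ℝ) : V → ℝ :=
  if h : ∃ p, IsStationary Q p then h.choose else 0

/-- The effective potential `-log π_i`. -/
noncomputable def effPotential {V : Type*} [Fintype V] (Q : Matrix V V ℝ) (i : V) : ℝ :=
  -Real.log (stationaryDist Q i)

/-- The log exit rate `log q_i`. -/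
noncomputable def logExitRate {V : Type*} [Fintype V] [DecidableEq V] (Q : Matrix V V ℝ) (i : V) :
    ℝ :=
  Real.log (exitRate Q i)

/-- The local-global correlation `ρ(Q) = Corr (-log π_I, log q_I)`, for `I` uniform on the states. -/
noncomputable def rho {V : Type*} [Fintype V] [DecidableEq V] (Q : Matrix V V ℝ) : ℝ :=
  unifCorr (effPotential Q) (logExitRate Q)

/-- `ρ(Q)` is well defined: there is a unique stationary distribution, it and the exit rates are
positive, and the two variances in the definition of `ρ(Q)` are positive. -/
structure RhoWellDefined {V : Type*} [Fintype V] [DecidableEq V] (Q : Matrix V V ℝ) : Prop where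
  existsUnique_stationary : ∃! p, IsStationary Q p
  stationary_pos : ∀ i, 0 < stationaryDist Q i
  exitRate_pos : ∀ i, 0 < exitRate Q i
  effPotential_var_pos : 0 < unifVar (effPotential Q)
  logExitRate_var_pos : 0 < unifVar (logExitRate Q)

/-- The transition rate matrix `Arr_G(w, b)`: the rates are `exp (w_i - b_{ij})` along the edges of
`G` and zero between distinct non-adjacent states, and the diagonal makes the rows sum to zero.
Only the values of `b` at adjacent pairs matter. -/
noncomputable def arr {V : Type*} [Fintype V] [DecidableEq V] (G : SimpleGraph V)
    [DecidableRel G.Adj] (w : V → ℝ) (b : V → V → ℝ) : Matrix V V ℝ :=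
  Matrix.of fun i j =>
    if i = j then -∑ k ∈ G.neighborFinset i, Real.exp (w i - b i k)
    else if G.Adj i j then Real.exp (w i - b i j)
    else 0

/-! ### Random energy landscapes -/

/-- `(W, B)` is a `(σW, σB)`-disordered energy landscape on `G`: the well depths are i.i.d.
`N(0, σW²)`, and the barrier heights are symmetric with law `N(0, σB²)`. -/
structure IsDisorderedLandscape {V Ω : Type*} [MeasurableSpace Ω] (P : Measure Ω)
    (G : SimpleGraph V) (σW σB : ℝ) (W : V → Ω → ℝ) (B : V → V → Ω → ℝ) : Prop where
  well_law : ∀ i, HasLaw (W i) (gaussianReal 0 (Real.toNNReal (σW ^ 2))) P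
  well_indep : iIndepFun W P
  barrier_symm : ∀ i j, G.Adj i j → B i j =ᵐ[P] B j i
  barrier_law : ∀ i j, G.Adj i j → HasLaw (B i j) (gaussianReal 0 (Real.toNNReal (σB ^ 2))) P

/-- `(W, B)` is separable: for some measurable `f` and some `σ > 0`, for every state `i`, the shifted
barrier heights `(B_{ij} - f(W_i))_{j ∼ i}` form a vector of i.i.d. `N(0, σ²)` random variables, and
this vector is independent of `W_i`. -/
def IsSeparable {V Ω : Type*} [MeasurableSpace Ω] (P : Measure Ω)
    (G : SimpleGraph V) (W : V → Ω → ℝ) (B : V → V → Ω → ℝ) : Prop :=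
  ∃ f : ℝ → ℝ, Measurable f ∧ ∃ σ : ℝ, 0 < σ ∧ ∀ i : V,
    (∀ j : G.neighborSet i,
      HasLaw (fun ω => B i j ω - f (W i ω)) (gaussianReal 0 (Real.toNNReal (σ ^ 2))) P) ∧
    iIndepFun (fun (j : G.neighborSet i) (ω : Ω) => B i j ω - f (W i ω)) P ∧
    IndepFun (fun (ω : Ω) (j : G.neighborSet i) => B i j ω - f (W i ω)) (W i) P

end Arrhenius

/-! The chain is reversible with conductances `exp (-b i j)`, so its stationary distribution is the
Gibbs measure of the wells and `-log π` is `w` up to an additive constant. Hence `ρ = Corr (W_I, log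
q_I)`, and `log q_i = W_i + D_i` with `D_i = log ∑_{j ∼ i} exp (-B_ij)`. An elementary inequality
(`one_sub_unifCorr_le`) gives `1 - ρ ≤ 2 Var D / Var W`. A weighted AM-GM inequality then separates
numerator from denominator, so that no independence between `D` and `W` is needed; it remains to
bound `E (Var D)²` and `E (Var W)⁻²`.

Numerator. By separability `D_i = Y - f(W_i)`, where `Y` is the log-sum-exp of `d` i.i.d. Gaussians
of variance `σ²`, independent of `W_i`. Its mean depends only on `d` and `σ`, so by regularity all
the `D_i` can be centered at the same constant, and `(Var D)²` is at most the average of the fourth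
powers. The central moments of `Y` are controlled without dependence on `d` by Gaussian rotation
(the Maurey-Pisier argument, `lintegral_logSumExpNeg_sub_pow_le`), because softmax weights sum to
one. Those of `f(W_i)` are read off from the Gaussian laws of `B_ij` and `B_ij - f(W_i)`
(`moments_of_add_gaussian`). Together they give the fourth moment bound `16 σB⁴`.

Denominator. Writing `r⁻²` as the integral of `t exp (-t r)` reduces the inverse second moment to
the Laplace transform of the sum of squared deviations, a chi-square with `n - 1` degrees of freedom
(`lintegral_inv_sum_sq_dev_sq_le`). The result is `n² / ((n - 5) (n - 3))` times `σW⁻⁴`, and the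
first factor is at most `(1 + 10 n^(-1/2))²`. -/

namespace Arrhenius

/-! ### Empirical variance, covariance and correlation -/

section Statistics

variable {V : Type*} [Fintype V]

lemma unifMean_add (x y : V → ℝ) :
    unifMean (fun i => x i + y i) = unifMean x + unifMean y := by
  simp only [unifMean, Finset.sum_add_distrib, add_div]

lemma unifMean_sub (x y : V → ℝ) :
    unifMean (fun i => x i - y i) = unifMean x - unifMean y := by
  simp only [unifMean, Finset.sum_sub_distrib, sub_div]

lemma unifMean_const_mul (c : ℝ) (x : V → ℝ) :
    unifMean (fun i => c * x i) = c * unifMean x := by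
  simp only [unifMean, ← Finset.mul_sum, mul_div_assoc]

lemma unifMean_const [Nonempty V] (c : ℝ) : unifMean (fun _ : V => c) = c := by
  have : (Fintype.card V : ℝ) ≠ 0 := Nat.cast_ne_zero.2 Fintype.card_ne_zero
  simp [unifMean, this]

lemma unifMean_nonneg {x : V → ℝ} (hx : ∀ i, 0 ≤ x i) : 0 ≤ unifMean x :=
  div_nonneg (Finset.sum_nonneg fun i _ => hx i) (Nat.cast_nonneg _)

lemma unifMean_add_const [Nonempty V] (x : V → ℝ) (c : ℝ) :
    unifMean (fun i => x i + c) = unifMean x + c := by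
  rw [unifMean_add, unifMean_const]

lemma unifCov_add_const_left [Nonempty V] (x y : V → ℝ) (c : ℝ) :
    unifCov (fun i => x i + c) y = unifCov x y := by
  simp only [unifCov, unifMean_add_const, add_sub_add_right_eq_sub]

lemma unifVar_add_const [Nonempty V] (x : V → ℝ) (c : ℝ) :
    unifVar (fun i => x i + c) = unifVar x := by
  simp only [unifVar, unifCov, unifMean_add_const, add_sub_add_right_eq_sub]

lemma unifVar_nonneg (x : V → ℝ) : 0 ≤ unifVar x :=
  unifMean_nonneg fun _ => mul_self_nonneg _

lemma unifVar_eq_unifMean_sub (x : V → ℝ) :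
    unifVar x = (∑ i, (x i - unifMean x) ^ 2) / (Fintype.card V : ℝ) := by
  simp only [unifVar, unifCov, unifMean, sq]

lemma unifVar_pos_of_ne {x : V → ℝ} {i j : V} (h : x i ≠ x j) : 0 < unifVar x := by
  have hV : (0 : ℝ) < Fintype.card V := Nat.cast_pos.2 (Fintype.card_pos_iff.2 ⟨i⟩)
  rw [unifVar_eq_unifMean_sub]
  refine div_pos (Finset.sum_pos' (fun _ _ => sq_nonneg _) ?_) hV
  by_cases hi : x i = unifMean x
  · exact ⟨j, Finset.mem_univ _, sq_pos_of_ne_zero (sub_ne_zero.2 fun hj => h (hi.trans hj.symm))⟩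
  · exact ⟨i, Finset.mem_univ _, sq_pos_of_ne_zero (sub_ne_zero.2 hi)⟩

lemma unifVar_sub (x y : V → ℝ) :
    unifVar (fun i => x i - y i) = unifVar x + unifVar y - 2 * unifCov x y := by
  have h : ∀ i, (x i - y i - (unifMean x - unifMean y)) * (x i - y i - (unifMean x - unifMean y))
      = (x i - unifMean x) * (x i - unifMean x) + (y i - unifMean y) * (y i - unifMean y)
        - 2 * ((x i - unifMean x) * (y i - unifMean y)) := fun i => by ring
  simp only [unifVar, unifCov, unifMean_sub x y, h]
  rw [unifMean_sub, unifMean_add, unifMean_const_mul]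

lemma unifCov_sq_le (x y : V → ℝ) : unifCov x y ^ 2 ≤ unifVar x * unifVar y := by
  simp only [unifVar_eq_unifMean_sub, unifCov, unifMean]
  rw [div_pow, div_mul_div_comm, ← sq]
  exact div_le_div_of_nonneg_right (Finset.sum_mul_sq_le_sq_mul_sq _ _ _) (by positivity)

lemma unifVar_le_unifMean_sub_sq [Nonempty V] (x : V → ℝ) (c : ℝ) :
    unifVar x ≤ unifMean fun i => (x i - c) ^ 2 := by
  have h : (unifMean fun i => (x i - c) ^ 2) = unifVar x + (unifMean x - c) ^ 2 := by
    have h1 : ∀ i, (x i - c) ^ 2 = (x i - unifMean x) * (x i - unifMean x)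
        + (2 * (unifMean x - c) * (x i - unifMean x) + (unifMean x - c) ^ 2) := fun i => by ring
    simp only [h1]
    rw [unifMean_add, unifMean_add_const, unifMean_const_mul, unifMean_sub, unifMean_const]
    simp [unifVar, unifCov]
  rw [h]
  exact le_add_of_nonneg_right (sq_nonneg _)

lemma unifMean_sq_le [Nonempty V] (x : V → ℝ) : unifMean x ^ 2 ≤ unifMean fun i => x i ^ 2 := by
  have h := unifVar_nonneg x
  have h1 : unifVar x = (unifMean fun i => x i ^ 2) - unifMean x ^ 2 := by
    have h1 : ∀ i, (x i - unifMean x) * (x i - unifMean x)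
        = x i ^ 2 - (2 * unifMean x * x i - unifMean x ^ 2) := fun i => by ring
    simp only [unifVar, unifCov, h1]
    rw [unifMean_sub, unifMean_sub, unifMean_const_mul, unifMean_const]
    ring
  linarith

/-- Cauchy-Schwarz. If a variance vanishes, division by zero gives 0, so no nondegeneracy is needed
and `rho` is bounded at every sample point. -/
lemma abs_unifCorr_le_one (x y : V → ℝ) : |unifCorr x y| ≤ 1 := by
  rw [unifCorr, abs_div, abs_of_nonneg (Real.sqrt_nonneg _)]
  exact div_le_one_of_le₀ (Real.abs_le_sqrt (unifCov_sq_le x y)) (Real.sqrt_nonneg _)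

/-- The correlation of `x` and `y` is close to one if `y - x` has a small variance. -/
lemma one_sub_unifCorr_le {x y : V → ℝ} (hx : 0 < unifVar x) (hy : 0 < unifVar y) :
    1 - unifCorr x y ≤ 2 * (unifVar (fun i => y i - x i) / unifVar x) := by
  have hc := abs_le.1 (abs_unifCorr_le_one x y)
  set r := unifCorr x y with hr
  obtain ⟨a, ha, hax⟩ : ∃ a, 0 < a ∧ unifVar x = a ^ 2 :=
    ⟨_, Real.sqrt_pos.2 hx, (Real.sq_sqrt hx.le).symm⟩
  obtain ⟨b, hb, hby⟩ : ∃ b, 0 < b ∧ unifVar y = b ^ 2 :=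
    ⟨_, Real.sqrt_pos.2 hy, (Real.sq_sqrt hy.le).symm⟩
  have hcov : unifCov y x = r * (a * b) := by
    have h1 : unifCov y x = unifCov x y := by
      simp only [unifCov]; congr 1; ext i; ring
    rw [hr, unifCorr, hax, hby, ← mul_pow, Real.sqrt_sq (by positivity), h1]
    field_simp
  rw [unifVar_sub, hcov, hax, hby, ← mul_div_assoc, le_div_iff₀ (by positivity)]
  -- With `Var (y - x) = a² + b² - 2rab`: if `r ≤ 0` the right side is at least `2 ≥ 1 - r`. If `r >
  -- 0`, minimizing over `b` leaves `2 (1 - r²)`, which exceeds `1 - r` by `(1 - r) (1 + 2r) ≥ 0`.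
  rcases le_or_gt r 0 with h0 | h0
  · nlinarith [mul_nonneg (neg_nonneg.2 h0) (mul_pos ha hb).le, sq_nonneg b,
      mul_nonneg (by linarith [hc.1] : 0 ≤ 1 + r) (sq_nonneg a)]
  · nlinarith [sq_nonneg (b - a * r), mul_nonneg (mul_nonneg (by linarith [hc.2] : 0 ≤ 1 - r)
      (by linarith : 0 ≤ 1 + 2 * r)) (sq_nonneg a)]

end Statistics

/-! ### The chain and its stationary distribution -/

/-- The Gibbs measure of the well depths. -/
noncomputable def gibbs {V : Type*} [Fintype V] (w : V → ℝ) (i : V) : ℝ :=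
  Real.exp (-w i) / ∑ k, Real.exp (-w k)

lemma sum_exp_neg_pos {V : Type*} [Fintype V] [Nonempty V] (w : V → ℝ) :
    0 < ∑ k, Real.exp (-w k) :=
  Finset.sum_pos (fun _ _ => Real.exp_pos _) Finset.univ_nonempty

section Chain

variable {V : Type*} [Fintype V] [DecidableEq V] {G : SimpleGraph V} [DecidableRel G.Adj]
  {w : V → ℝ} {b : V → V → ℝ}

lemma exitRate_arr (i : V) :
    exitRate (arr G w b) i = ∑ k ∈ G.neighborFinset i, Real.exp (w i - b i k) := by
  rw [exitRate]
  symm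
  apply Finset.sum_subset_zero_on_sdiff
  · intro k hk
    simpa using ((G.mem_neighborFinset i k).1 hk).ne'
  · intro k hk
    simp only [Finset.mem_sdiff, Finset.mem_erase, Finset.mem_univ, and_true,
      SimpleGraph.mem_neighborFinset] at hk
    simp [arr, hk.2, Ne.symm hk.1]
  · intro k hk
    have h := (G.mem_neighborFinset i k).1 hk
    simp [arr, h, h.ne]

lemma logExitRate_arr {i : V} (hi : (G.neighborFinset i).Nonempty) :
    logExitRate (arr G w b) i
      = w i + Real.log (∑ k ∈ G.neighborFinset i, Real.exp (-b i k)) := by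
  rw [logExitRate, exitRate_arr]
  simp only [sub_eq_add_neg, Real.exp_add, ← Finset.mul_sum]
  rw [Real.log_mul (Real.exp_ne_zero _), Real.log_exp]
  exact (Finset.sum_pos (fun _ _ => Real.exp_pos _) hi).ne'

/-- Symmetry of the barriers turns `p Q` into a weighted graph Laplacian of `p i * exp (w i)`, so
stationarity becomes harmonicity. -/
lemma vecMul_arr (hb : ∀ i j, G.Adj i j → b i j = b j i) (p : V → ℝ) (j : V) :
    (p ᵥ* arr G w b) j = ∑ i ∈ G.neighborFinset j,
      Real.exp (-b j i) * (p i * Real.exp (w i) - p j * Real.exp (w j)) := by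
  rw [Matrix.vecMul, dotProduct, ← Finset.add_sum_erase _ _ (Finset.mem_univ j)]
  have h1 : ∑ i ∈ Finset.univ.erase j, p i * arr G w b i j
      = ∑ i ∈ G.neighborFinset j, Real.exp (-b j i) * (p i * Real.exp (w i)) := by
    symm
    apply Finset.sum_subset_zero_on_sdiff
    · intro k hk
      simpa using ((G.mem_neighborFinset j k).1 hk).ne'
    · intro k hk
      simp only [Finset.mem_sdiff, Finset.mem_erase, Finset.mem_univ, and_true,
        SimpleGraph.mem_neighborFinset] at hk
      simp [arr, G.adj_comm k j, hk.2, hk.1]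
    · intro k hk
      have h := (G.mem_neighborFinset j k).1 hk
      simp only [arr, Matrix.of_apply, h.ne', h.symm, if_true, if_false, sub_eq_add_neg,
        Real.exp_add, hb _ _ h]
      ring
  rw [h1]
  simp only [arr, Matrix.of_apply, if_true, sub_eq_add_neg, Real.exp_add, mul_neg, Finset.mul_sum]
  rw [add_comm, ← sub_eq_add_neg, ← Finset.sum_sub_distrib]
  exact Finset.sum_congr rfl fun _ _ => by ring

lemma isStationary_gibbs [Nonempty V] (hb : ∀ i j, G.Adj i j → b i j = b j i) :
    IsStationary (arr G w b) (gibbs w) where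
  nonneg i := div_nonneg (Real.exp_pos _).le (sum_exp_neg_pos w).le
  sum_eq_one := by
    simp only [gibbs, ← Finset.sum_div]
    exact div_self (sum_exp_neg_pos w).ne'
  vecMul_eq_zero := by
    ext j
    rw [vecMul_arr hb]
    refine Finset.sum_eq_zero fun i _ => ?_
    have h : ∀ k, gibbs w k * Real.exp (w k) = 1 / ∑ k, Real.exp (-w k) := fun k => by
      rw [gibbs, div_mul_eq_mul_div, ← Real.exp_add, neg_add_cancel, Real.exp_zero]
    rw [h, h, sub_self, mul_zero]

/-- Maximum principle: `p i * exp (w i)` is harmonic, so its maximum spreads to neighbours and, by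
connectedness, to every vertex. Normalization fixes the constant. -/
lemma IsStationary.eq_gibbs (hG : G.Connected) (hb : ∀ i j, G.Adj i j → b i j = b j i)
    {p : V → ℝ} (hp : IsStationary (arr G w b) p) : p = gibbs w := by
  have := hG.nonempty
  set r : V → ℝ := fun i => p i * Real.exp (w i) with hr
  obtain ⟨m, -, hm⟩ := Finset.exists_max_image Finset.univ r Finset.univ_nonempty
  have hstep : ∀ i j, G.Adj i j → r i = r m → r j = r m := by
    intro i j hij hi
    have h0 := congrFun hp.vecMul_eq_zero i
    rw [vecMul_arr hb, Pi.zero_apply, Finset.sum_eq_zero_iff_of_nonpos] at h0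
    · have := h0 j ((G.mem_neighborFinset i j).2 hij)
      rw [mul_eq_zero, or_iff_right (Real.exp_ne_zero _)] at this
      rw [← hi]
      exact sub_eq_zero.1 this
    · intro k _
      exact mul_nonpos_of_nonneg_of_nonpos (Real.exp_pos _).le
        (sub_nonpos.2 ((hm k (Finset.mem_univ _)).trans_eq hi.symm))
  have hall : ∀ j, r j = r m := by
    intro j
    obtain ⟨q⟩ := hG.preconnected m j
    have : ∀ {u v : V} (q : G.Walk u v), r u = r m → r v = r m := by
      intro u v q
      induction q with
      | nil => exact id
      | cons h _ ih => exact fun hu => ih (hstep _ _ h hu)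
    exact this q rfl
  have hpj : ∀ j, p j = r m * Real.exp (-w j) := fun j => by
    rw [← hall j, hr, mul_assoc, ← Real.exp_add, add_neg_cancel, Real.exp_zero, mul_one]
  have hs := hp.sum_eq_one
  simp only [hpj, ← Finset.mul_sum] at hs
  ext j
  rw [hpj, gibbs, eq_div_iff (sum_exp_neg_pos w).ne', mul_right_comm, hs, one_mul]

lemma stationaryDist_arr (hG : G.Connected) (hb : ∀ i j, G.Adj i j → b i j = b j i) :
    stationaryDist (arr G w b) = gibbs w := by
  have := hG.nonempty
  have h : ∃ p, IsStationary (arr G w b) p := ⟨_, isStationary_gibbs hb⟩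
  rw [stationaryDist, dif_pos h]
  exact h.choose_spec.eq_gibbs hG hb

lemma effPotential_arr (hG : G.Connected) (hb : ∀ i j, G.Adj i j → b i j = b j i) :
    effPotential (arr G w b) = fun i => w i + Real.log (∑ k, Real.exp (-w k)) := by
  have := hG.nonempty
  ext i
  rw [effPotential, stationaryDist_arr hG hb, gibbs, Real.log_div (Real.exp_ne_zero _)
    (sum_exp_neg_pos w).ne', Real.log_exp]
  ring

lemma rho_arr (hG : G.Connected) (hb : ∀ i j, G.Adj i j → b i j = b j i) :
    rho (arr G w b) = unifCorr w (logExitRate (arr G w b)) := by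
  have := hG.nonempty
  rw [rho, effPotential_arr hG hb, unifCorr, unifCov_add_const_left, unifVar_add_const, ← unifCorr]

lemma exitRate_arr_pos {i : V} (hi : (G.neighborFinset i).Nonempty) :
    0 < exitRate (arr G w b) i := by
  rw [exitRate_arr]
  exact Finset.sum_pos (fun _ _ => Real.exp_pos _) hi

lemma rhoWellDefined_arr (hG : G.Connected) (hb : ∀ i j, G.Adj i j → b i j = b j i)
    (hn : ∀ i, (G.neighborFinset i).Nonempty) (hw : 0 < unifVar w)
    (hq : ∃ i j, exitRate (arr G w b) i ≠ exitRate (arr G w b) j) :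
    RhoWellDefined (arr G w b) where
  existsUnique_stationary := by
    have := hG.nonempty
    exact ⟨_, isStationary_gibbs hb, fun p hp => hp.eq_gibbs hG hb⟩
  stationary_pos i := by
    have := hG.nonempty
    rw [stationaryDist_arr hG hb]
    exact div_pos (Real.exp_pos _) (sum_exp_neg_pos w)
  exitRate_pos i := exitRate_arr_pos (hn i)
  effPotential_var_pos := by
    have := hG.nonempty
    rwa [effPotential_arr hG hb, unifVar_add_const]
  logExitRate_var_pos := by
    obtain ⟨i, j, hij⟩ := hq
    refine unifVar_pos_of_ne (i := i) (j := j) fun h => hij ?_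
    exact Real.log_injOn_pos (exitRate_arr_pos (hn i)) (exitRate_arr_pos (hn j)) h

end Chain

/-! ### Moments of sums of independent variables -/

section Moments

variable {Ω : Type*} [MeasurableSpace Ω] {P : Measure Ω} [IsProbabilityMeasure P]

lemma integrable_pow_of_memLp {X : Ω → ℝ} {n k : ℕ} (hX : MemLp X n P) (hk : k ≤ n) :
    Integrable (fun ω => X ω ^ k) P := by
  have h := (hX.mono_exponent (p := (k : ENNReal)) (by exact_mod_cast hk)).integrable_norm_pow'
  refine h.mono (hX.aestronglyMeasurable.pow k) (Filter.Eventually.of_forall fun ω => ?_)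
  simp

lemma integral_add_pow_of_indepFun {X Y : Ω → ℝ} {n k : ℕ} (hX : MemLp X n P) (hY : MemLp Y n P)
    (hXY : IndepFun X Y P) (hk : k ≤ n) :
    ∫ ω, (X ω + Y ω) ^ k ∂P = ∑ j ∈ Finset.range (k + 1),
      (∫ ω, X ω ^ j ∂P) * (∫ ω, Y ω ^ (k - j) ∂P) * (k.choose j : ℝ) := by
  have hind : ∀ j, IndepFun (fun ω => X ω ^ j) (fun ω => Y ω ^ (k - j)) P := fun j =>
    hXY.comp (measurable_id.pow_const j) (measurable_id.pow_const (k - j))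
  simp only [add_pow]
  rw [integral_finsetSum]
  · refine Finset.sum_congr rfl fun j hj => ?_
    rw [integral_mul_const]
    congr 1
    exact (hind j).integral_fun_mul_eq_mul_integral
      (hX.aestronglyMeasurable.pow j) (hY.aestronglyMeasurable.pow _)
  · intro j hj
    have hj' : j ≤ k := Nat.lt_succ_iff.1 (Finset.mem_range.1 hj)
    exact ((hind j).integrable_mul (integrable_pow_of_memLp hX (hj'.trans hk))
      (integrable_pow_of_memLp hY ((Nat.sub_le k j).trans hk))).mul_const _

end Moments

/-! ### Low moments of the centered Gaussian -/

section GaussianMoments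

variable (v : NNReal)

lemma memLp_gaussianReal (n : ℕ) : MemLp (fun x : ℝ => x) n (gaussianReal 0 v) :=
  memLp_id_gaussianReal' n (ENNReal.natCast_ne_top n)

lemma integral_sq_gaussianReal : ∫ x, x ^ 2 ∂gaussianReal 0 v = v := by
  have h := variance_fun_id_gaussianReal (μ := 0) (v := v)
  rw [variance_eq_sub (memLp_gaussianReal v 2)] at h
  simpa using h

lemma integral_cube_gaussianReal : ∫ x, x ^ 3 ∂gaussianReal 0 v = 0 := by
  have h : ∫ x, x ^ 3 ∂gaussianReal 0 v = ∫ x, (-x) ^ 3 ∂gaussianReal 0 v := by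
    conv_lhs => rw [← neg_zero, ← gaussianReal_map_neg]
    rw [integral_map (by fun_prop) (by fun_prop)]
  have h2 : ∀ x : ℝ, (-x) ^ 3 = -x ^ 3 := fun x => by ring
  simp only [h2, integral_neg] at h
  linarith

/-- Rotating by `π / 4` shows that `(X + Y) / √2` has the law of `X` for an independent copy `Y`.
Expanding gives `m₄ = (2 m₄ + 6 v²) / 4`. -/
lemma integral_pow_four_gaussianReal : ∫ x, x ^ 4 ∂gaussianReal 0 v = 3 * (v : ℝ) ^ 2 := by
  set μ := gaussianReal 0 v
  have hmem := memLp_gaussianReal v 4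
  have hfst : HasLaw (fun p : ℝ × ℝ => p.1) μ (μ.prod μ) :=
    ⟨by fun_prop, Measure.fst_prod (μ := μ) (ν := μ)⟩
  have hsnd : HasLaw (fun p : ℝ × ℝ => p.2) μ (μ.prod μ) :=
    ⟨by fun_prop, Measure.snd_prod (μ := μ) (ν := μ)⟩
  have hind : IndepFun (fun p : ℝ × ℝ => p.1) (fun p : ℝ × ℝ => p.2) (μ.prod μ) :=
    indepFun_prod measurable_id measurable_id
  have hm1 : MemLp (fun p : ℝ × ℝ => p.1) (4 : ℕ) (μ.prod μ) :=
    by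
    simpa [Function.comp_def] using hmem.comp_measurePreserving
      (hfst.measurePreserving measurable_fst)
  have hm2 : MemLp (fun p : ℝ × ℝ => p.2) (4 : ℕ) (μ.prod μ) :=
    by
    simpa [Function.comp_def] using hmem.comp_measurePreserving
      (hsnd.measurePreserving measurable_snd)
  have hi1 : ∀ k : ℕ, ∫ p : ℝ × ℝ, p.1 ^ k ∂μ.prod μ = ∫ x, x ^ k ∂μ := fun k =>
    hfst.integral_comp (f := fun x => x ^ k) (by fun_prop)
  have hi2 : ∀ k : ℕ, ∫ p : ℝ × ℝ, p.2 ^ k ∂μ.prod μ = ∫ x, x ^ k ∂μ := fun k =>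
    hsnd.integral_comp (f := fun x => x ^ k) (by fun_prop)
  have hrot := IsGaussian.map_rotation_eq_self (μ := μ) (by simp [μ]) (Real.pi / 4)
  have h1 : ∫ x, x ^ 4 ∂μ = ∫ p : ℝ × ℝ, (Real.sqrt 2 / 2 * (p.1 + p.2)) ^ 4 ∂μ.prod μ := by
    rw [← hi1]
    conv_lhs => rw [← hrot]
    rw [integral_map (by fun_prop) (by fun_prop)]
    simp [ContinuousLinearMap.rotation_apply, mul_add]
  have h2 : (Real.sqrt 2 / 2) ^ 4 = 1 / 4 := by
    have : Real.sqrt 2 ^ 2 = 2 := Real.sq_sqrt (by norm_num)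
    rw [div_pow, show Real.sqrt 2 ^ 4 = (Real.sqrt 2 ^ 2) ^ 2 by ring, this]
    norm_num
  simp only [mul_pow, h2] at h1
  rw [integral_const_mul, integral_add_pow_of_indepFun hm1 hm2 hind le_rfl] at h1
  simp only [Finset.sum_range_succ, Finset.sum_range_zero, hi1, hi2] at h1
  have e1 : ∫ x, x ∂μ = 0 := integral_id_gaussianReal
  have e2 : ∫ x, x ^ 2 ∂μ = v := integral_sq_gaussianReal v
  have e3 : ∫ x, x ^ 3 ∂μ = 0 := integral_cube_gaussianReal v
  norm_num [e1, e2, e3, Nat.choose] at h1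
  linarith

end GaussianMoments

/-! ### Dimension-free concentration of log-sum-exp by Gaussian rotation -/

section LogSumExp

variable {ι : Type*} [Fintype ι]

/-- The function `x ↦ log ∑ⱼ exp (-xⱼ)`. -/
noncomputable def logSumExpNeg (x : ι → ℝ) : ℝ := Real.log (∑ j, Real.exp (-x j))

lemma continuous_gibbs_apply [Nonempty ι] (j : ι) : Continuous fun x : ι → ℝ => gibbs x j :=
  Continuous.div (by fun_prop) (by fun_prop) fun x => (sum_exp_neg_pos x).ne'

lemma continuous_logSumExpNeg [Nonempty ι] : Continuous (logSumExpNeg (ι := ι)) :=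
  Continuous.log (by fun_prop) fun x => (sum_exp_neg_pos x).ne'

lemma gibbs_nonneg (x : ι → ℝ) (j : ι) : 0 ≤ gibbs x j :=
  div_nonneg (Real.exp_pos _).le (Finset.sum_nonneg fun _ _ => (Real.exp_pos _).le)

lemma sum_gibbs [Nonempty ι] (x : ι → ℝ) : ∑ j, gibbs x j = 1 := by
  simp only [gibbs, ← Finset.sum_div]
  exact div_self (sum_exp_neg_pos x).ne'

/-- Here `gibbs` plays the role of the softmax: it is minus the gradient of `logSumExpNeg`. -/
lemma hasDerivAt_logSumExpNeg [Nonempty ι] {c : ℝ → ι → ℝ} {c' : ι → ℝ} {t : ℝ}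
    (hc : ∀ j, HasDerivAt (fun s => c s j) (c' j) t) :
    HasDerivAt (fun s => logSumExpNeg (c s)) (-∑ j, gibbs (c t) j * c' j) t := by
  have h := (HasDerivAt.fun_sum (u := Finset.univ) fun j _ => (hc j).fun_neg.exp).log
    (sum_exp_neg_pos (c t)).ne'
  refine h.congr_deriv ?_
  rw [Finset.sum_div, ← Finset.sum_neg_distrib]
  exact Finset.sum_congr rfl fun j _ => by rw [gibbs]; ring

/-- Jensen for the normalized Lebesgue measure on the interval. -/
lemma intervalIntegral_pow_le {g : ℝ → ℝ} (hg : Continuous g) {a : ℝ} (ha : 0 < a) {p : ℕ}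
    (hp : Even p) :
    (∫ t in (0)..a, g t) ^ p ≤ a ^ p * (a⁻¹ * ∫ t in (0)..a, g t ^ p) := by
  have h := (hp.convexOn_pow (𝕜 := ℝ)).map_set_average_le (μ := volume) (t := Set.Ioc 0 a) (f := g)
    (continuous_pow p).continuousOn isClosed_univ (by simp [ha]) (by simp)
    (Filter.Eventually.of_forall fun _ => Set.mem_univ _) hg.integrableOn_Ioc
    (hg.pow p).integrableOn_Ioc
  simp only [setAverage_eq, smul_eq_mul, Measure.real, Real.volume_Ioc, sub_zero,
    ENNReal.toReal_ofReal ha.le, mul_pow, ← intervalIntegral.integral_of_le ha.le] at h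
  calc (∫ t in (0)..a, g t) ^ p = a ^ p * (a⁻¹ ^ p * (∫ t in (0)..a, g t) ^ p) := by
        rw [← mul_assoc, ← mul_pow, mul_inv_cancel₀ ha.ne', one_pow, one_mul]
    _ ≤ _ := mul_le_mul_of_nonneg_left h (pow_nonneg ha.le p)

/-- The pairing of the softmax weights of the first vector with the `p`-th powers of the entries of
the second one. -/
noncomputable def softmaxPow (p : ℕ) (u : (ι → ℝ) × (ι → ℝ)) : ℝ := ∑ j, gibbs u.1 j * u.2 j ^ p

lemma continuous_softmaxPow [Nonempty ι] (p : ℕ) : Continuous (softmaxPow (ι := ι) p) :=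
  continuous_finsetSum _ fun j _ =>
    ((continuous_gibbs_apply j).comp continuous_fst).mul (by fun_prop)

lemma softmaxPow_nonneg {p : ℕ} (hp : Even p) (u : (ι → ℝ) × (ι → ℝ)) : 0 ≤ softmaxPow p u :=
  Finset.sum_nonneg fun j _ => mul_nonneg (gibbs_nonneg _ j) (hp.pow_nonneg _)

lemma continuous_softmaxPow_rotation_left [Nonempty ι] (p : ℕ) (u : (ι → ℝ) × (ι → ℝ)) :
    Continuous fun t => softmaxPow p (ContinuousLinearMap.rotation t u) := by
  have hrot : Continuous fun t : ℝ => ContinuousLinearMap.rotation t u := by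
    simp only [ContinuousLinearMap.rotation_apply]
    fun_prop
  exact (continuous_softmaxPow p).comp hrot

/-- The first component of the rotated pair runs from `u.1` at angle 0 to `u.2` at angle `π / 2`,
and its velocity is the second component. The increment is thus an integral of softmax averages;
Jensen is applied once in the angle and once to the softmax weights. -/
lemma logSumExpNeg_sub_pow_le [Nonempty ι] {p : ℕ} (hp : Even p) (u : (ι → ℝ) × (ι → ℝ)) :
    (logSumExpNeg u.2 - logSumExpNeg u.1) ^ p ≤ (Real.pi / 2) ^ p * ((Real.pi / 2)⁻¹ *
      ∫ t in (0)..(Real.pi / 2), softmaxPow p (ContinuousLinearMap.rotation t u)) := by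
  have hd : ∀ t : ℝ, HasDerivAt
      (fun s => logSumExpNeg (ContinuousLinearMap.rotation s u).1)
      (-softmaxPow 1 (ContinuousLinearMap.rotation t u)) t := by
    intro t
    refine (hasDerivAt_logSumExpNeg (c' := (ContinuousLinearMap.rotation t u).2)
      fun j => ?_).congr_deriv (by simp [softmaxPow])
    simp only [ContinuousLinearMap.rotation_apply, Pi.add_apply, Pi.smul_apply, smul_eq_mul]
    exact ((Real.hasDerivAt_cos t).mul_const _).add ((Real.hasDerivAt_sin t).mul_const _)
  have hcont : Continuous fun t : ℝ => -softmaxPow 1 (ContinuousLinearMap.rotation t u) :=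
    (continuous_softmaxPow_rotation_left 1 u).neg
  have hFTC := intervalIntegral.integral_eq_sub_of_hasDerivAt (a := 0) (b := Real.pi / 2)
    (fun t _ => hd t) (hcont.intervalIntegrable _ _)
  simp only [ContinuousLinearMap.rotation_apply (Real.pi / 2), ContinuousLinearMap.rotation_apply 0,
    Real.cos_zero, Real.sin_zero, Real.cos_pi_div_two, Real.sin_pi_div_two, one_smul, zero_smul,
    zero_add, add_zero] at hFTC
  rw [← hFTC]
  have hpi : 0 < Real.pi / 2 := by positivity
  refine (intervalIntegral_pow_le hcont hpi hp).trans ?_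
  gcongr
  refine intervalIntegral.integral_mono_on hpi.le ((hcont.pow p).intervalIntegrable _ _)
    ((continuous_softmaxPow_rotation_left p u).intervalIntegrable _ _) fun t _ => ?_
  rw [hp.neg_pow]
  simp only [softmaxPow, pow_one]
  exact Real.pow_arith_mean_le_arith_mean_pow_of_even _ _ _ (fun j _ => gibbs_nonneg _ j)
    (sum_gibbs _) hp

lemma isGaussian_pi_gaussianReal (v : NNReal) :
    IsGaussian (Measure.pi fun _ : ι => gaussianReal 0 v) := by
  have h : iIndepFun (fun (j : ι) (x : ι → ℝ) => x j) (Measure.pi fun _ : ι => gaussianReal 0 v) :=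
    iIndepFun_pi (X := fun _ x => x) fun _ => aemeasurable_id
  have h2 := (h.hasGaussianLaw fun j => ⟨by
    rw [(measurePreserving_eval (fun _ : ι => gaussianReal 0 v) j).map_eq]
    infer_instance⟩).isGaussian_map
  simpa using h2

lemma map_rotation_pi_gaussianReal (v : NNReal) (t : ℝ) :
    ((Measure.pi fun _ : ι => gaussianReal 0 v).prod (Measure.pi fun _ : ι => gaussianReal 0 v)).map
      (ContinuousLinearMap.rotation t)
      = (Measure.pi fun _ : ι => gaussianReal 0 v).prod
        (Measure.pi fun _ : ι => gaussianReal 0 v) := by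
  have := isGaussian_pi_gaussianReal (ι := ι) v
  refine IsGaussian.map_rotation_eq_self ?_ t
  ext j
  simp only [id_eq]
  rw [eval_integral]
  · have h := (measurePreserving_eval (fun _ : ι => gaussianReal 0 v) j).hasLaw.integral_eq
    simpa using h
  · intro k
    exact (measurePreserving_eval (fun _ : ι => gaussianReal 0 v) k).integrable_comp_of_integrable
      ((memLp_gaussianReal v 1).integrable (by simp))

/-- The weights depend only on the first vector and sum to one, while every entry of the independent
second vector has the same `p`-th moment. This is where the dimension drops out. -/
lemma lintegral_softmaxPow [Nonempty ι] (v : NNReal) {p : ℕ} (hp : Even p) :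
    ∫⁻ u, ENNReal.ofReal (softmaxPow p u) ∂(Measure.pi fun _ : ι => gaussianReal 0 v).prod
        (Measure.pi fun _ : ι => gaussianReal 0 v)
      = ∫⁻ x, ENNReal.ofReal (x ^ p) ∂gaussianReal 0 v := by
  have hc := continuous_softmaxPow (ι := ι) p
  rw [lintegral_prod _ (by fun_prop)]
  have h : ∀ x : ι → ℝ, ∫⁻ y, ENNReal.ofReal (softmaxPow p (x, y))
      ∂(Measure.pi fun _ : ι => gaussianReal 0 v)
      = ∫⁻ x, ENNReal.ofReal (x ^ p) ∂gaussianReal 0 v := by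
    intro x
    have h1 : ∀ y : ι → ℝ, ENNReal.ofReal (softmaxPow p (x, y))
        = ∑ j, ENNReal.ofReal (gibbs x j) * ENNReal.ofReal (y j ^ p) := fun y => by
      rw [softmaxPow, ENNReal.ofReal_sum_of_nonneg fun j _ =>
        mul_nonneg (gibbs_nonneg _ j) (hp.pow_nonneg _)]
      exact Finset.sum_congr rfl fun j _ => ENNReal.ofReal_mul (gibbs_nonneg _ j)
    have h2 : ∀ j, ∫⁻ y : ι → ℝ, ENNReal.ofReal (y j ^ p) ∂(Measure.pi fun _ : ι => gaussianReal 0 v)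
        = ∫⁻ x, ENNReal.ofReal (x ^ p) ∂gaussianReal 0 v := fun j =>
      (measurePreserving_eval (fun _ : ι => gaussianReal 0 v) j).hasLaw.lintegral_comp
        (f := fun x => ENNReal.ofReal (x ^ p)) (by fun_prop)
    simp only [h1]
    rw [lintegral_finsetSum _ fun j _ => by fun_prop]
    simp only [lintegral_const_mul' _ _ ENNReal.ofReal_ne_top, h2, ← Finset.sum_mul]
    rw [← ENNReal.ofReal_sum_of_nonneg fun j _ => gibbs_nonneg _ j, sum_gibbs, ENNReal.ofReal_one,
      one_mul]
  simp [h]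

lemma continuous_softmaxPow_rotation [Nonempty ι] (p : ℕ) :
    Continuous fun z : ((ι → ℝ) × (ι → ℝ)) × ℝ =>
      softmaxPow p (ContinuousLinearMap.rotation z.2 z.1) := by
  have hrot : Continuous fun z : ((ι → ℝ) × (ι → ℝ)) × ℝ =>
      ContinuousLinearMap.rotation z.2 z.1 := by
    simp only [ContinuousLinearMap.rotation_apply]
    fun_prop
  exact (continuous_softmaxPow p).comp hrot

lemma lintegral_softmaxPow_rotation [Nonempty ι] (v : NNReal) {p : ℕ} (hp : Even p) (t : ℝ) :
    ∫⁻ u, ENNReal.ofReal (softmaxPow p (ContinuousLinearMap.rotation t u))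
        ∂(Measure.pi fun _ : ι => gaussianReal 0 v).prod (Measure.pi fun _ : ι => gaussianReal 0 v)
      = ∫⁻ x, ENNReal.ofReal (x ^ p) ∂gaussianReal 0 v := by
  have hm : Measurable fun u : (ι → ℝ) × (ι → ℝ) => ENNReal.ofReal (softmaxPow p u) :=
    (continuous_softmaxPow p).measurable.ennreal_ofReal
  have hr : Measurable (ContinuousLinearMap.rotation t : (ι → ℝ) × (ι → ℝ) →L[ℝ] _) :=
    (ContinuousLinearMap.continuous _).measurable
  have h := lintegral_map (μ := (Measure.pi fun _ : ι => gaussianReal 0 v).prod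
    (Measure.pi fun _ : ι => gaussianReal 0 v)) hm hr
  rw [map_rotation_pi_gaussianReal v t] at h
  exact h.symm.trans (lintegral_softmaxPow v hp)

lemma ofReal_logSumExpNeg_sub_pow_le [Nonempty ι] {p : ℕ} (hp : Even p)
    (u : (ι → ℝ) × (ι → ℝ)) :
    ENNReal.ofReal ((logSumExpNeg u.2 - logSumExpNeg u.1) ^ p)
      ≤ ENNReal.ofReal ((Real.pi / 2) ^ p) * (ENNReal.ofReal (Real.pi / 2)⁻¹ *
        ∫⁻ t in Set.Ioc 0 (Real.pi / 2),
          ENNReal.ofReal (softmaxPow p (ContinuousLinearMap.rotation t u))) := by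
  have hpi : 0 < Real.pi / 2 := by positivity
  have hline : Continuous fun t => softmaxPow p (ContinuousLinearMap.rotation t u) :=
    continuous_softmaxPow_rotation_left p u
  have h1 := ofReal_integral_eq_lintegral_ofReal (μ := volume.restrict (Set.Ioc 0 (Real.pi / 2)))
    hline.integrableOn_Ioc (Filter.Eventually.of_forall fun t => softmaxPow_nonneg hp _)
  have h2 := logSumExpNeg_sub_pow_le hp u
  rw [← h1, ← intervalIntegral.integral_of_le hpi.le, ← ENNReal.ofReal_mul (inv_nonneg.2 hpi.le),
    ← ENNReal.ofReal_mul (pow_nonneg hpi.le p)]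
  exact ENNReal.ofReal_le_ofReal h2

/-- By Tonelli and rotation invariance, every angle contributes the same Gaussian moment. -/
lemma lintegral_logSumExpNeg_sub_pow_le [Nonempty ι] (v : NNReal) {p : ℕ} (hp : Even p) :
    ∫⁻ u, ENNReal.ofReal ((logSumExpNeg u.2 - logSumExpNeg u.1) ^ p)
        ∂(Measure.pi fun _ : ι => gaussianReal 0 v).prod (Measure.pi fun _ : ι => gaussianReal 0 v)
      ≤ ENNReal.ofReal ((Real.pi / 2) ^ p) * ∫⁻ x, ENNReal.ofReal (x ^ p) ∂gaussianReal 0 v := by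
  have hrot := lintegral_softmaxPow_rotation (ι := ι) v hp
  generalize hμ : (Measure.pi fun _ : ι => gaussianReal 0 v).prod
    (Measure.pi fun _ : ι => gaussianReal 0 v) = μ at hrot ⊢
  have : SFinite μ := by rw [← hμ]; infer_instance
  have hpi : 0 < Real.pi / 2 := by positivity
  have hmeas : Measurable fun z : ((ι → ℝ) × (ι → ℝ)) × ℝ =>
      ENNReal.ofReal (softmaxPow p (ContinuousLinearMap.rotation z.2 z.1)) :=
    (continuous_softmaxPow_rotation (ι := ι) p).measurable.ennreal_ofReal
  have hswap : ∫⁻ u, (∫⁻ t in Set.Ioc 0 (Real.pi / 2),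
        ENNReal.ofReal (softmaxPow p (ContinuousLinearMap.rotation t u))) ∂μ
      = ∫⁻ t in Set.Ioc 0 (Real.pi / 2), ∫⁻ u,
        ENNReal.ofReal (softmaxPow p (ContinuousLinearMap.rotation t u)) ∂μ :=
    lintegral_lintegral_swap
      (f := fun u t => ENNReal.ofReal (softmaxPow p (ContinuousLinearMap.rotation t u)))
      hmeas.aemeasurable
  calc _ ≤ ∫⁻ u, ENNReal.ofReal ((Real.pi / 2) ^ p) * (ENNReal.ofReal (Real.pi / 2)⁻¹ *
        ∫⁻ t in Set.Ioc 0 (Real.pi / 2),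
          ENNReal.ofReal (softmaxPow p (ContinuousLinearMap.rotation t u))) ∂μ :=
        lintegral_mono fun u => ofReal_logSumExpNeg_sub_pow_le hp u
    _ = _ := by
        rw [lintegral_const_mul' _ _ ENNReal.ofReal_ne_top,
          lintegral_const_mul' _ _ ENNReal.ofReal_ne_top, hswap]
        simp only [hrot, lintegral_const, Measure.restrict_apply_univ, Real.volume_Ioc, sub_zero]
        rw [mul_comm (lintegral _ _), ← mul_assoc (ENNReal.ofReal _⁻¹),
          ← ENNReal.ofReal_mul (by positivity), inv_mul_cancel₀ hpi.ne', ENNReal.ofReal_one,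
          one_mul]

end LogSumExp

/-! ### Laplace transform of the sum of squared deviations -/

section GaussianLaplace

/-- Completing the square: with `k = 1 + 2sv`, the integrand is a multiple of the density of
`N(av/k, v/k)`. Negative `s` is allowed and will be needed. -/
lemma lintegral_exp_quadratic_gaussianReal {v : NNReal} (hv : v ≠ 0) {s : ℝ} (hs : 0 < 1 + 2 * s * v)
    (a : ℝ) :
    ∫⁻ x, ENNReal.ofReal (Real.exp (-s * x ^ 2 + a * x)) ∂gaussianReal 0 v
      = ENNReal.ofReal ((Real.sqrt (1 + 2 * s * v))⁻¹ *
        Real.exp (a ^ 2 * v / (2 * (1 + 2 * s * v)))) := by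
  have hv0 : (0 : ℝ) < v := NNReal.coe_pos.2 (pos_iff_ne_zero.2 hv)
  obtain ⟨k, hk⟩ : ∃ k : NNReal, (k : ℝ) = 1 + 2 * s * v := ⟨⟨_, hs.le⟩, rfl⟩
  have hk0 : (0 : ℝ) < k := hk ▸ hs
  have hk1 : k ≠ 0 := fun h => hk0.ne' (by simp [h])
  have hvk : v / k ≠ 0 := div_ne_zero hv hk1
  have key : ∀ x : ℝ, gaussianPDF 0 v x * ENNReal.ofReal (Real.exp (-s * x ^ 2 + a * x))
      = ENNReal.ofReal ((Real.sqrt k)⁻¹ * Real.exp (a ^ 2 * v / (2 * k)))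
        * gaussianPDF (a * v / k) (v / k) x := by
    intro x
    rw [gaussianPDF, gaussianPDF, ← ENNReal.ofReal_mul (gaussianPDFReal_nonneg _ _ _),
      ← ENNReal.ofReal_mul (by positivity)]
    congr 1
    have hsq : Real.sqrt (2 * Real.pi * v) = Real.sqrt k * Real.sqrt (2 * Real.pi * (v / k)) := by
      rw [← Real.sqrt_mul hk0.le]
      congr 1
      field_simp
    have hs' : s = (k - 1) / (2 * v) := by rw [hk]; field_simp; ring
    simp only [gaussianPDFReal, NNReal.coe_div, hsq]
    rw [mul_assoc, ← Real.exp_add, mul_inv, mul_mul_mul_comm, ← Real.exp_add]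
    congr 2
    rw [hs']
    field_simp
    ring
  rw [gaussianReal_of_var_ne_zero 0 hv, lintegral_withDensity_eq_lintegral_mul _
    (measurable_gaussianPDF 0 v) (by fun_prop)]
  simp only [Pi.mul_apply, key]
  rw [lintegral_const_mul _ (measurable_gaussianPDF _ _), lintegral_gaussianPDF_eq_one _ hvk,
    mul_one, hk]

variable {V : Type*} [Fintype V]

lemma sum_sub_unifMean_sq [Nonempty V] (x : V → ℝ) :
    ∑ i, (x i - unifMean x) ^ 2 = ∑ i, x i ^ 2 - (∑ i, x i) ^ 2 / Fintype.card V := by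
  have hn : (Fintype.card V : ℝ) ≠ 0 := Nat.cast_ne_zero.2 Fintype.card_ne_zero
  simp only [sub_sq, Finset.sum_add_distrib, Finset.sum_sub_distrib, ← Finset.mul_sum,
    ← Finset.sum_mul, unifMean, Finset.sum_const, Finset.card_univ, nsmul_eq_mul]
  field_simp
  ring

lemma lintegral_exp_quadratic_pi {v : NNReal} (hv : v ≠ 0) {t : ℝ} (ht : 0 < 1 + 2 * t * v)
    (a : ℝ) :
    ∫⁻ x, ENNReal.ofReal (Real.exp (-t * ∑ i, x i ^ 2 + a * ∑ i, x i))
        ∂(Measure.pi fun _ : V => gaussianReal 0 v)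
      = ENNReal.ofReal ((Real.sqrt (1 + 2 * t * v))⁻¹ ^ Fintype.card V *
        Real.exp (Fintype.card V * (a ^ 2 * v / (2 * (1 + 2 * t * v))))) := by
  have hind : iIndepFun (fun (i : V) (x : V → ℝ) =>
      ENNReal.ofReal (Real.exp (-t * x i ^ 2 + a * x i)))
      (Measure.pi fun _ : V => gaussianReal 0 v) :=
    iIndepFun_pi (X := fun _ (y : ℝ) => ENNReal.ofReal (Real.exp (-t * y ^ 2 + a * y)))
      fun _ => by fun_prop
  have h1 : ∀ x : V → ℝ, ENNReal.ofReal (Real.exp (-t * ∑ i, x i ^ 2 + a * ∑ i, x i))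
      = ∏ i, ENNReal.ofReal (Real.exp (-t * x i ^ 2 + a * x i)) := fun x => by
    rw [← ENNReal.ofReal_prod_of_nonneg fun i _ => (Real.exp_pos _).le, ← Real.exp_sum,
      Finset.sum_add_distrib, Finset.mul_sum, Finset.mul_sum]
  have h2 : ∀ i : V, ∫⁻ x : V → ℝ, ENNReal.ofReal (Real.exp (-t * x i ^ 2 + a * x i))
      ∂(Measure.pi fun _ : V => gaussianReal 0 v) = _ := fun i =>
    ((measurePreserving_eval (fun _ : V => gaussianReal 0 v) i).hasLaw.lintegral_comp
      (f := fun y => ENNReal.ofReal (Real.exp (-t * y ^ 2 + a * y))) (by fun_prop)).trans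
      (lintegral_exp_quadratic_gaussianReal hv ht a)
  simp only [h1]
  rw [lintegral_prod_eq_prod_lintegral_of_indepFun _ _ hind fun i => by fun_prop]
  simp only [h2, Finset.prod_const, Finset.card_univ]
  rw [← ENNReal.ofReal_pow (by positivity), mul_pow, ← Real.exp_nat_mul]

/-- The Laplace transform of the sum of the squared deviations from the mean of a Gaussian sample. -/
lemma lintegral_exp_neg_sum_sq_dev [Nonempty V] {v : NNReal} (hv : v ≠ 0) {t : ℝ} (ht : 0 ≤ t) :
    ∫⁻ x, ENNReal.ofReal (Real.exp (-(t * ∑ i, (x i - unifMean x) ^ 2)))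
        ∂(Measure.pi fun _ : V => gaussianReal 0 v)
      = ENNReal.ofReal ((Real.sqrt (1 + 2 * t * v))⁻¹ ^ (Fintype.card V - 1)) := by
  have hn : (0 : ℝ) < Fintype.card V := Nat.cast_pos.2 Fintype.card_pos
  have hv0 : (0 : ℝ) < v := NNReal.coe_pos.2 (pos_iff_ne_zero.2 hv)
  have hk : 0 < 1 + 2 * t * v := by positivity
  -- This `c` linearizes the square of the sum: `exp (t (∑ x)² / n)` is the mean of `exp (c z ∑ x)`
  -- over a standard Gaussian `z`, after which the coordinates decouple.
  set c := Real.sqrt (2 * t / Fintype.card V) with hc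
  have hc2 : c ^ 2 = 2 * t / Fintype.card V := Real.sq_sqrt (by positivity)
  have h1 : ∀ x : V → ℝ, ENNReal.ofReal (Real.exp (-(t * ∑ i, (x i - unifMean x) ^ 2)))
      = ∫⁻ z, ENNReal.ofReal (Real.exp (-t * ∑ i, x i ^ 2 + (c * z) * ∑ i, x i))
        ∂gaussianReal 0 1 := by
    intro x
    have h := lintegral_exp_quadratic_gaussianReal one_ne_zero (s := 0) (by norm_num)
      (c * ∑ i, x i)
    have h3 : ∀ z : ℝ, ENNReal.ofReal (Real.exp (-t * ∑ i, x i ^ 2 + (c * z) * ∑ i, x i))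
        = ENNReal.ofReal (Real.exp (-t * ∑ i, x i ^ 2)) *
          ENNReal.ofReal (Real.exp (-0 * z ^ 2 + (c * ∑ i, x i) * z)) := fun z => by
      rw [← ENNReal.ofReal_mul (Real.exp_pos _).le, ← Real.exp_add]
      congr 2
      ring
    simp only [h3]
    rw [lintegral_const_mul' _ _ ENNReal.ofReal_ne_top, h,
      ← ENNReal.ofReal_mul (Real.exp_pos _).le]
    congr 1
    simp only [mul_zero, add_zero, Real.sqrt_one, inv_one, one_mul, mul_one,
      NNReal.coe_one]
    rw [← Real.exp_add, sum_sub_unifMean_sq, mul_pow, hc2]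
    congr 1
    field_simp
    ring
  simp only [h1]
  rw [lintegral_lintegral_swap (by fun_prop)]
  simp only [lintegral_exp_quadratic_pi hv hk]
  have h4 : ∀ z : ℝ, ENNReal.ofReal ((Real.sqrt (1 + 2 * t * v))⁻¹ ^ Fintype.card V *
        Real.exp (Fintype.card V * ((c * z) ^ 2 * v / (2 * (1 + 2 * t * v)))))
      = ENNReal.ofReal ((Real.sqrt (1 + 2 * t * v))⁻¹ ^ Fintype.card V) *
        ENNReal.ofReal (Real.exp (-(-(t * v / (1 + 2 * t * v))) * z ^ 2 + 0 * z)) := fun z => by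
    rw [ENNReal.ofReal_mul (by positivity)]
    congr 3
    rw [mul_pow, hc2]
    field_simp
    ring
  have h5 : 1 + 2 * -(t * v / (1 + 2 * t * v)) * ((1 : NNReal) : ℝ) = (1 + 2 * t * v)⁻¹ := by
    rw [NNReal.coe_one]
    field_simp
    ring
  -- Integrating out the auxiliary `z` returns one factor `√(1 + 2tv)`, which lowers the exponent
  -- from `n` to `n - 1`.
  have h6 := lintegral_exp_quadratic_gaussianReal one_ne_zero (s := -(t * v / (1 + 2 * t * v)))
    (by rw [h5]; positivity) 0
  simp only [h4]
  rw [lintegral_const_mul' _ _ ENNReal.ofReal_ne_top, h6, h5,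
    ← ENNReal.ofReal_mul (by positivity), Real.sqrt_inv, inv_inv]
  congr 1
  have hs : Real.sqrt (1 + 2 * t * v) ≠ 0 := (Real.sqrt_pos.2 hk).ne'
  obtain ⟨m, hm⟩ : ∃ m, Fintype.card V = m + 1 := ⟨_, (Nat.succ_pred Fintype.card_ne_zero).symm⟩
  rw [hm]
  simp [pow_succ]
  field_simp

end GaussianLaplace

/-! ### Inverse second moment of the empirical variance -/

section InverseSquare

lemma lintegral_mul_exp_neg {r : ℝ} (hr : 0 < r) :
    ∫⁻ t in Set.Ioi 0, ENNReal.ofReal (t * Real.exp (-(t * r))) = ENNReal.ofReal ((r⁻¹) ^ 2) := by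
  have h := Real.integral_rpow_mul_exp_neg_mul_Ioi (a := 2) (by norm_num) hr
  have h2 : ∀ t : ℝ, t ^ ((2 : ℝ) - 1) * Real.exp (-(r * t)) = t * Real.exp (-(t * r)) := fun t => by
    rw [show (2 : ℝ) - 1 = 1 by norm_num, Real.rpow_one, mul_comm r]
  simp only [h2, Real.Gamma_two, mul_one, Real.rpow_two, one_div] at h
  rw [← h, ofReal_integral_eq_lintegral_ofReal]
  · by_contra hi
    rw [integral_undef hi] at h
    have : 0 < r⁻¹ ^ 2 := by positivity
    exact this.ne h
  · filter_upwards [ae_restrict_mem measurableSet_Ioi] with t ht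
    exact mul_nonneg (le_of_lt ht) (Real.exp_pos _).le

/-- The inverse is taken in `ENNReal`, so `r = 0` gives `⊤` on the left. The integral diverges as
well, by comparison with arbitrarily small positive `r`. -/
lemma inv_ofReal_sq_le_lintegral {r : ℝ} (hr : 0 ≤ r) :
    (ENNReal.ofReal r)⁻¹ ^ 2 ≤ ∫⁻ t in Set.Ioi 0, ENNReal.ofReal (t * Real.exp (-(t * r))) := by
  rcases hr.eq_or_lt with rfl | hr
  · suffices h : ∫⁻ t in Set.Ioi 0, ENNReal.ofReal (t * Real.exp (-(t * 0))) = ⊤ by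
      rw [h]; exact le_top
    refine ENNReal.eq_top_of_forall_nnreal_le fun x => ?_
    have hx : (0 : ℝ) < x + 1 := by positivity
    have hs : 0 < (Real.sqrt (x + 1))⁻¹ := by positivity
    calc (x : ENNReal) = ENNReal.ofReal x := (ENNReal.ofReal_coe_nnreal).symm
      _ ≤ ENNReal.ofReal (((Real.sqrt (x + 1))⁻¹)⁻¹ ^ 2) := by
          rw [inv_inv, Real.sq_sqrt hx.le]
          exact ENNReal.ofReal_le_ofReal (by linarith)
      _ = _ := (lintegral_mul_exp_neg hs).symm
      _ ≤ _ := by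
          refine setLIntegral_mono' measurableSet_Ioi fun t ht => ENNReal.ofReal_le_ofReal ?_
          refine mul_le_mul_of_nonneg_left (Real.exp_le_exp.2 ?_) (le_of_lt ht)
          rw [mul_zero, neg_zero, neg_nonpos]
          exact mul_nonneg (le_of_lt ht) hs.le
  · rw [lintegral_mul_exp_neg hr, ENNReal.ofReal_pow (by positivity), ENNReal.ofReal_inv_of_pos hr]

lemma lintegral_mul_inv_sqrt_pow {v : ℝ} (hv : 0 < v) (k : ℕ) :
    ∫⁻ t in Set.Ioi 0, ENNReal.ofReal (t * (Real.sqrt (1 + 2 * t * v))⁻¹ ^ (k + 5))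
      = ENNReal.ofReal (1 / (v ^ 2 * ((k + 1) * (k + 3)))) := by
  set q : ℝ → ℝ := fun t => (Real.sqrt (1 + 2 * t * v))⁻¹ with hq
  -- An antiderivative, found from `q' = -v q³` and `2vt q² = 1 - q²`: the integrand equals `q^(k+3)
  -- (1 - q²) / (2v)`.
  set A : ℝ → ℝ := fun t => (-(q t ^ (k + 1) / (k + 1)) + q t ^ (k + 3) / (k + 3)) / (2 * v ^ 2)
    with hA
  have hpos : ∀ t ∈ Set.Ici (0 : ℝ), 0 < 1 + 2 * t * v := fun t ht => by
    have : 0 ≤ t := ht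
    positivity
  have hq2 : ∀ t ∈ Set.Ici (0 : ℝ), 1 - q t ^ 2 = 2 * v * t * q t ^ 2 := fun t ht => by
    have h := hpos t ht
    simp only [hq, inv_pow, Real.sq_sqrt h.le]
    field_simp
    ring
  have hqd : ∀ t ∈ Set.Ici (0 : ℝ), HasDerivAt q (-v * q t ^ 3) t := by
    intro t ht
    have h := hpos t ht
    have hs : 0 < Real.sqrt (1 + 2 * t * v) := Real.sqrt_pos.2 h
    have h1 : HasDerivAt (fun t : ℝ => 1 + 2 * t * v) (2 * v) t := by
      simpa using (((hasDerivAt_id t).const_mul 2).mul_const v).const_add 1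
    refine ((h1.sqrt h.ne').inv hs.ne').congr_deriv ?_
    simp only [hq]
    field_simp
  have hd : ∀ t ∈ Set.Ici (0 : ℝ), HasDerivAt A (t * q t ^ (k + 5)) t := by
    intro t ht
    have h1 := ((((hqd t ht).pow (k + 1)).div_const (k + 1 : ℝ)).neg.add
      (((hqd t ht).pow (k + 3)).div_const (k + 3 : ℝ))).div_const (2 * v ^ 2)
    refine h1.congr_deriv ?_
    have e1 : (k : ℝ) + 1 ≠ 0 := by positivity
    have e3 : (k : ℝ) + 3 ≠ 0 := by positivity
    have h2 := hq2 t ht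
    push_cast
    calc _ = q t ^ (k + 3) * (1 - q t ^ 2) / (2 * v) := by field_simp; ring
      _ = _ := by rw [h2]; field_simp; ring
  have hq0 : Filter.Tendsto q Filter.atTop (nhds 0) := by
    refine Filter.Tendsto.inv_tendsto_atTop (Real.tendsto_sqrt_atTop.comp ?_)
    refine Filter.tendsto_atTop_add_const_left _ _ ?_
    exact (Filter.tendsto_id.const_mul_atTop (by norm_num)).atTop_mul_const hv
  have hlim : Filter.Tendsto A Filter.atTop (nhds 0) := by
    have := (((hq0.pow (k + 1)).div_const (k + 1 : ℝ)).neg.add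
      ((hq0.pow (k + 3)).div_const (k + 3 : ℝ))).div_const (2 * v ^ 2)
    simpa using this
  have hnn : ∀ t ∈ Set.Ioi (0 : ℝ), 0 ≤ t * q t ^ (k + 5) := fun t ht =>
    mul_nonneg (le_of_lt ht) (by positivity)
  have hint := integral_Ioi_of_hasDerivAt_of_nonneg' hd hnn hlim
  rw [← ofReal_integral_eq_lintegral_ofReal (integrableOn_Ioi_deriv_of_nonneg' hd hnn hlim)
    ((ae_restrict_mem measurableSet_Ioi).mono hnn), hint]
  congr 1
  simp only [hA, hq]
  norm_num
  field_simp
  ring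

variable {V : Type*} [Fintype V]

lemma lintegral_inv_sum_sq_dev_sq_le {v : NNReal} (hv : v ≠ 0) (hV : 6 ≤ Fintype.card V) :
    ∫⁻ x, (ENNReal.ofReal (∑ i, (x i - unifMean x) ^ 2))⁻¹ ^ 2
        ∂(Measure.pi fun _ : V => gaussianReal 0 v)
      ≤ ENNReal.ofReal (1 / ((v : ℝ) ^ 2 *
        (((Fintype.card V : ℝ) - 5) * ((Fintype.card V : ℝ) - 3)))) := by
  have hne : Nonempty V := Fintype.card_pos_iff.1 (by omega)
  -- The Laplace exponent is `n - 1 = k + 5`. Convergence of the integral of `t (1 +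
  -- 2tv)^(-(n-1)/2)` at infinity requires `n - 1 > 4`, hence six vertices.
  obtain ⟨k, hk⟩ : ∃ k, Fintype.card V = k + 6 := ⟨_, (Nat.sub_add_cancel hV).symm⟩
  have hv0 : (0 : ℝ) < v := NNReal.coe_pos.2 (pos_iff_ne_zero.2 hv)
  have hmean : Measurable fun x : V → ℝ => unifMean x := by
    unfold unifMean
    fun_prop
  calc _ ≤ ∫⁻ x : V → ℝ, (∫⁻ t in Set.Ioi 0, ENNReal.ofReal
          (t * Real.exp (-(t * ∑ i, (x i - unifMean x) ^ 2))))
          ∂(Measure.pi fun _ : V => gaussianReal 0 v) :=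
        lintegral_mono fun x => inv_ofReal_sq_le_lintegral
          (Finset.sum_nonneg fun i _ => sq_nonneg _)
    _ = ∫⁻ t in Set.Ioi 0, (∫⁻ x : V → ℝ, ENNReal.ofReal
          (t * Real.exp (-(t * ∑ i, (x i - unifMean x) ^ 2)))
          ∂(Measure.pi fun _ : V => gaussianReal 0 v)) :=
        lintegral_lintegral_swap (f := fun (x : V → ℝ) (t : ℝ) => ENNReal.ofReal
          (t * Real.exp (-(t * ∑ i, (x i - unifMean x) ^ 2)))) (by fun_prop)
    _ = ∫⁻ t in Set.Ioi 0, ENNReal.ofReal (t * (Real.sqrt (1 + 2 * t * v))⁻¹ ^ (k + 5)) := by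
        refine setLIntegral_congr_fun measurableSet_Ioi fun t ht => ?_
        have ht0 : (0 : ℝ) ≤ t := le_of_lt ht
        simp only [ENNReal.ofReal_mul ht0]
        rw [lintegral_const_mul' _ _ ENNReal.ofReal_ne_top, lintegral_exp_neg_sum_sq_dev hv ht0, hk]
        rfl
    _ = _ := by
        rw [lintegral_mul_inv_sqrt_pow hv0, hk]
        congr 3
        push_cast
        ring

variable {Ω : Type*} [MeasurableSpace Ω] {P : Measure Ω} {W : V → Ω → ℝ} {v : NNReal}

lemma hasLaw_pi_of_iIndepFun [IsProbabilityMeasure P] {ν : V → Measure ℝ}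
    (hlaw : ∀ i, HasLaw (W i) (ν i) P) (hind : iIndepFun W P) :
    HasLaw (fun ω i => W i ω) (Measure.pi ν) P where
  aemeasurable := aemeasurable_pi_lambda _ fun i => (hlaw i).aemeasurable
  map_eq := by
    rw [hind.map_fun_eq_pi_map fun i => (hlaw i).aemeasurable]
    simp only [(hlaw _).map_eq]

lemma measurable_unifVar : Measurable fun x : V → ℝ => unifVar x := by
  simp only [unifVar_eq_unifMean_sub, unifMean]
  fun_prop

/-- The inverse of the empirical variance of a Gaussian sample of size at least six is square
integrable. -/
lemma unifVar_inv_sq_of_gaussian [IsProbabilityMeasure P] (hv : v ≠ 0) (hV : 6 ≤ Fintype.card V)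
    (hlaw : ∀ i, HasLaw (W i) (gaussianReal 0 v) P) (hind : iIndepFun W P) :
    (∀ᵐ ω ∂P, 0 < unifVar fun i => W i ω) ∧
    Integrable (fun ω => (unifVar fun i => W i ω)⁻¹ ^ 2) P ∧
    ∫ ω, (unifVar fun i => W i ω)⁻¹ ^ 2 ∂P ≤ (Fintype.card V : ℝ) ^ 2 / ((v : ℝ) ^ 2 *
        (((Fintype.card V : ℝ) - 5) * ((Fintype.card V : ℝ) - 3))) := by
  have hW := hasLaw_pi_of_iIndepFun hlaw hind
  have hn6 : (6 : ℝ) ≤ Fintype.card V := by exact_mod_cast hV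
  have hn : (0 : ℝ) < Fintype.card V := by linarith
  have hmeas : Measurable fun x : V → ℝ => unifVar x := measurable_unifVar
  have hle := lintegral_inv_sum_sq_dev_sq_le (V := V) hv hV
  have hscale : ∀ x : V → ℝ, (ENNReal.ofReal (unifVar x))⁻¹ ^ 2
      = ENNReal.ofReal ((Fintype.card V : ℝ) ^ 2) *
        (ENNReal.ofReal (∑ i, (x i - unifMean x) ^ 2))⁻¹ ^ 2 := fun x => by
    rw [unifVar_eq_unifMean_sub, ENNReal.ofReal_div_of_pos hn, ENNReal.inv_div
      (Or.inl ENNReal.ofReal_ne_top) (Or.inl (ENNReal.ofReal_pos.2 hn).ne'), div_eq_mul_inv, mul_pow,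
      ENNReal.ofReal_pow hn.le]
  have hbound : ∫⁻ ω, (ENNReal.ofReal (unifVar fun i => W i ω))⁻¹ ^ 2 ∂P
      ≤ ENNReal.ofReal ((Fintype.card V : ℝ) ^ 2 / ((v : ℝ) ^ 2 *
        (((Fintype.card V : ℝ) - 5) * ((Fintype.card V : ℝ) - 3)))) := by
    rw [hW.lintegral_comp (f := fun x => (ENNReal.ofReal (unifVar x))⁻¹ ^ 2) (by fun_prop)]
    simp only [hscale]
    rw [lintegral_const_mul' _ _ ENNReal.ofReal_ne_top, div_eq_mul_one_div,
      ENNReal.ofReal_mul (by positivity)]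
    gcongr
  have haem : AEMeasurable (fun ω => unifVar fun i => W i ω) P :=
    hmeas.comp_aemeasurable hW.aemeasurable
  have hpos : ∀ᵐ ω ∂P, 0 < unifVar fun i => W i ω := by
    -- A zero variance would make the `ENNReal` inverse infinite, so finiteness of its integral
    -- already yields almost sure positivity.
    filter_upwards [ae_lt_top' (by fun_prop) (hbound.trans_lt ENNReal.ofReal_lt_top).ne] with ω hω
    refine (unifVar_nonneg _).lt_of_ne' fun h0 => ?_
    simp [h0] at hω
  have hcongr : ∫⁻ ω, ENNReal.ofReal ((unifVar fun i => W i ω)⁻¹ ^ 2) ∂P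
      = ∫⁻ ω, (ENNReal.ofReal (unifVar fun i => W i ω))⁻¹ ^ 2 ∂P := by
    refine lintegral_congr_ae (hpos.mono fun ω hω => ?_)
    simp only
    rw [ENNReal.ofReal_pow (inv_nonneg.2 hω.le), ENNReal.ofReal_inv_of_pos hω]
  rw [← hcongr] at hbound
  have hsm : AEStronglyMeasurable (fun ω => (unifVar fun i => W i ω)⁻¹ ^ 2) P :=
    (haem.inv.pow_const 2).aestronglyMeasurable
  have hnn : 0 ≤ᵐ[P] fun ω => (unifVar fun i => W i ω)⁻¹ ^ 2 :=
    Filter.Eventually.of_forall fun ω => sq_nonneg _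
  refine ⟨hpos, ⟨hsm, ?_⟩, ?_⟩
  · rw [hasFiniteIntegral_iff_ofReal hnn]
    exact hbound.trans_lt ENNReal.ofReal_lt_top
  · rw [integral_eq_lintegral_of_nonneg_ae hnn hsm]
    refine ENNReal.toReal_le_of_le_ofReal ?_ hbound
    exact div_nonneg (sq_nonneg _) (mul_nonneg (sq_nonneg _)
      (mul_nonneg (by linarith) (by linarith)))

end InverseSquare

/-! ### Central moments of log-sum-exp -/

section LogSumExpMoments

variable {ι : Type*} [Fintype ι] [Nonempty ι]

/-- A crude bound that depends on the dimension, used only to have all moments finite. -/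
lemma abs_logSumExpNeg_le (x : ι → ℝ) :
    |logSumExpNeg x| ≤ Real.log (Fintype.card ι) + ∑ j, |x j| := by
  have hcard : (0 : ℝ) < Fintype.card ι := Nat.cast_pos.2 Fintype.card_pos
  have hlog : 0 ≤ Real.log (Fintype.card ι) := Real.log_natCast_nonneg _
  have hj : ∀ j, |x j| ≤ ∑ j, |x j| := fun j =>
    Finset.single_le_sum (f := fun j => |x j|) (fun _ _ => abs_nonneg _) (Finset.mem_univ j)
  rw [logSumExpNeg, abs_le]
  constructor
  · obtain ⟨j⟩ := ‹Nonempty ι›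
    have h1 : -x j ≤ Real.log (∑ j, Real.exp (-x j)) :=
      (Real.le_log_iff_exp_le (sum_exp_neg_pos x)).2
        (Finset.single_le_sum (f := fun j => Real.exp (-x j)) (fun _ _ => (Real.exp_pos _).le)
          (Finset.mem_univ j))
    linarith [hj j, le_abs_self (x j)]
  · rw [Real.log_le_iff_le_exp (sum_exp_neg_pos x), Real.exp_add, Real.exp_log hcard]
    calc ∑ j, Real.exp (-x j) ≤ ∑ _j : ι, Real.exp (∑ j, |x j|) :=
          Finset.sum_le_sum fun j _ => Real.exp_le_exp.2 ((neg_le_abs _).trans (hj j))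
      _ = _ := by simp

lemma memLp_logSumExpNeg (v : NNReal) (n : ℕ) :
    MemLp (logSumExpNeg (ι := ι)) n (Measure.pi fun _ : ι => gaussianReal 0 v) := by
  have h1 : ∀ j, MemLp (fun x : ι → ℝ => |x j|) n (Measure.pi fun _ : ι => gaussianReal 0 v) :=
    fun j => ((memLp_gaussianReal v n).comp_measurePreserving
      (measurePreserving_eval (fun _ : ι => gaussianReal 0 v) j)).abs
  have h2 : MemLp (fun _ : ι → ℝ => Real.log (Fintype.card ι)) n
      (Measure.pi fun _ : ι => gaussianReal 0 v) := memLp_const _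
  have h3 : MemLp (fun x : ι → ℝ => ∑ j, |x j|) n (Measure.pi fun _ : ι => gaussianReal 0 v) :=
    memLp_finsetSum _ fun j _ => h1 j
  refine (h2.add h3).mono continuous_logSumExpNeg.aestronglyMeasurable
    (Filter.Eventually.of_forall fun x => ?_)
  exact (abs_logSumExpNeg_le x).trans (le_abs_self _)

variable (ι) in
/-- The mean of `log ∑ⱼ exp (-εⱼ)` for i.i.d. centered Gaussian random variables `εⱼ`. -/
noncomputable def logSumExpMean (v : NNReal) : ℝ :=
  ∫ x : ι → ℝ, logSumExpNeg x ∂Measure.pi fun _ : ι => gaussianReal 0 v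

lemma memLp_logSumExpNeg_sub (v : NNReal) (n : ℕ) :
    MemLp (fun x : ι → ℝ => logSumExpNeg x - logSumExpMean ι v) n
      (Measure.pi fun _ : ι => gaussianReal 0 v) :=
  (memLp_logSumExpNeg v n).sub (memLp_const _)

lemma integral_logSumExpNeg_sub (v : NNReal) :
    ∫ x : ι → ℝ, (logSumExpNeg x - logSumExpMean ι v) ∂Measure.pi (fun _ : ι => gaussianReal 0 v)
      = 0 := by
  rw [integral_sub ((memLp_logSumExpNeg v 1).integrable (by simp)) (integrable_const _)]
  simp [logSumExpMean]

lemma integral_logSumExpNeg_sub_pow_le (v : NNReal) {p : ℕ} (hp : Even p) :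
    ∫ u : (ι → ℝ) × (ι → ℝ), (logSumExpNeg u.2 - logSumExpNeg u.1) ^ p
        ∂(Measure.pi fun _ : ι => gaussianReal 0 v).prod (Measure.pi fun _ : ι => gaussianReal 0 v)
      ≤ (Real.pi / 2) ^ p * ∫ x, x ^ p ∂gaussianReal 0 v := by
  have hc := continuous_logSumExpNeg (ι := ι)
  have hnn : 0 ≤ ∫ x, x ^ p ∂gaussianReal 0 v := integral_nonneg fun x => hp.pow_nonneg x
  rw [integral_eq_lintegral_of_nonneg_ae (Filter.Eventually.of_forall fun u => hp.pow_nonneg _)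
    (by fun_prop)]
  refine ENNReal.toReal_le_of_le_ofReal (by positivity) ?_
  refine (lintegral_logSumExpNeg_sub_pow_le v hp).trans_eq ?_
  rw [ENNReal.ofReal_mul (by positivity), ofReal_integral_eq_lintegral_ofReal
    (integrable_pow_of_memLp (memLp_gaussianReal v p) le_rfl)
    (Filter.Eventually.of_forall fun x => hp.pow_nonneg x)]

/-- Symmetrization: the moments of the difference of two independent copies, in terms of the central
moments. -/
lemma integral_logSumExpNeg_sub_pow_eq (v : NNReal) (k : ℕ) :
    ∫ u : (ι → ℝ) × (ι → ℝ), (logSumExpNeg u.2 - logSumExpNeg u.1) ^ k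
        ∂(Measure.pi fun _ : ι => gaussianReal 0 v).prod (Measure.pi fun _ : ι => gaussianReal 0 v)
      = ∑ j ∈ Finset.range (k + 1),
        (∫ x : ι → ℝ, (logSumExpNeg x - logSumExpMean ι v) ^ j
          ∂Measure.pi fun _ : ι => gaussianReal 0 v) *
        ((-1) ^ (k - j) * ∫ x : ι → ℝ, (logSumExpNeg x - logSumExpMean ι v) ^ (k - j)
          ∂Measure.pi fun _ : ι => gaussianReal 0 v) * (k.choose j : ℝ) := by
  have hc := continuous_logSumExpNeg (ι := ι)
  have hmem := memLp_logSumExpNeg_sub (ι := ι) v k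
  set μ := Measure.pi fun _ : ι => gaussianReal 0 v
  set H : (ι → ℝ) → ℝ := fun x => logSumExpNeg x - logSumExpMean ι v with hH
  have hHc : Continuous H := hc.sub continuous_const
  have h1 : MeasurePreserving (Prod.fst : (ι → ℝ) × (ι → ℝ) → _) (μ.prod μ) μ :=
    measurePreserving_fst
  have h2 : MeasurePreserving (Prod.snd : (ι → ℝ) × (ι → ℝ) → _) (μ.prod μ) μ :=
    measurePreserving_snd
  have hm1 : MemLp (fun u : (ι → ℝ) × (ι → ℝ) => -H u.1) k (μ.prod μ) :=
    (hmem.comp_measurePreserving h1).neg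
  have hm2 : MemLp (fun u : (ι → ℝ) × (ι → ℝ) => H u.2) k (μ.prod μ) :=
    hmem.comp_measurePreserving h2
  have hind : IndepFun (fun u : (ι → ℝ) × (ι → ℝ) => H u.2) (fun u => -H u.1) (μ.prod μ) :=
    (indepFun_prod (μ := μ) (ν := μ) (X := fun x => -H x) (Y := H) hHc.neg.measurable
      hHc.measurable).symm
  have hexp := integral_add_pow_of_indepFun hm2 hm1 hind le_rfl
  have hl : ∀ u : (ι → ℝ) × (ι → ℝ), logSumExpNeg u.2 - logSumExpNeg u.1 = H u.2 + -H u.1 :=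
    fun u => by simp only [hH]; ring
  simp only [hl, hexp]
  refine Finset.sum_congr rfl fun j _ => ?_
  congr 2
  · exact h2.hasLaw.integral_comp (f := fun x => H x ^ j) (by fun_prop)
  · simp only [neg_pow (H _)]
    rw [integral_const_mul]
    congr 1
    exact h1.hasLaw.integral_comp (f := fun x => H x ^ (k - j)) (by fun_prop)

/-- Symmetrization doubles the variance, so it is at most `π² v / 8`, and `π² ≤ 10`. -/
lemma integral_logSumExpNeg_sub_mean_sq_le (v : NNReal) :
    ∫ x : ι → ℝ, (logSumExpNeg x - logSumExpMean ι v) ^ 2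
      ∂Measure.pi (fun _ : ι => gaussianReal 0 v) ≤ 5 / 4 * v := by
  have h := integral_logSumExpNeg_sub_pow_le (ι := ι) v (p := 2) even_two
  rw [integral_logSumExpNeg_sub_pow_eq, integral_sq_gaussianReal] at h
  simp [Finset.sum_range_succ, integral_logSumExpNeg_sub] at h
  have hpi : Real.pi ^ 2 ≤ 10 := by nlinarith [Real.pi_lt_d2, Real.pi_pos]
  nlinarith [v.coe_nonneg]

/-- Symmetrization gives `2 m₄ + 6 m₂² ≤ (π / 2)⁴ · 3 v²`; the term in `m₂²` is dropped and `π⁴ ≤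
100`. -/
lemma integral_logSumExpNeg_sub_mean_pow_four_le (v : NNReal) :
    ∫ x : ι → ℝ, (logSumExpNeg x - logSumExpMean ι v) ^ 4
      ∂Measure.pi (fun _ : ι => gaussianReal 0 v) ≤ 75 / 8 * (v : ℝ) ^ 2 := by
  have h := integral_logSumExpNeg_sub_pow_le (ι := ι) v (p := 4) (by decide)
  rw [integral_logSumExpNeg_sub_pow_eq, integral_pow_four_gaussianReal] at h
  norm_num [Finset.sum_range_succ, integral_logSumExpNeg_sub, Nat.choose] at h
  have hpi : Real.pi ^ 2 ≤ 10 := by nlinarith [Real.pi_lt_d2, Real.pi_pos]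
  have hpi4 : Real.pi ^ 4 ≤ 100 := by nlinarith [sq_nonneg Real.pi]
  have h2 := sq_nonneg (∫ x : ι → ℝ, (logSumExpNeg x - logSumExpMean ι v) ^ 2
      ∂Measure.pi (fun _ : ι => gaussianReal 0 v))
  nlinarith [sq_nonneg (v : ℝ)]

end LogSumExpMoments

/-! ### Fourth moment at a single state -/

section SeparableState

lemma memLp_of_hasLaw_gaussianReal {Ω : Type*} [MeasurableSpace Ω] {P : Measure Ω} {X : Ω → ℝ}
    {v : NNReal} (hX : HasLaw X (gaussianReal 0 v) P) (n : ℕ) : MemLp X n P := by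
  have h := memLp_gaussianReal v n
  rw [← hX.map_eq] at h
  exact (memLp_map_measure_iff (by fun_prop) hX.aemeasurable).1 h

lemma integral_pow_of_hasLaw {Ω : Type*} [MeasurableSpace Ω] {P : Measure Ω} {X : Ω → ℝ}
    {μ : Measure ℝ} (hX : HasLaw X μ P) (k : ℕ) :
    ∫ ω, X ω ^ k ∂P = ∫ x, x ^ k ∂μ :=
  hX.integral_comp (f := fun x => x ^ k) (by fun_prop)

variable {Ω : Type*} [MeasurableSpace Ω] {P : Measure Ω} [IsProbabilityMeasure P]

/-- If `X` and `ε` are independent and `ε`, `X + ε` are centered Gaussian, then the first four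
moments of `X` are those of a centered Gaussian. -/
lemma moments_of_add_gaussian {X ε : Ω → ℝ} {s v : NNReal} (hε : HasLaw ε (gaussianReal 0 s) P)
    (hXε : HasLaw (fun ω => X ω + ε ω) (gaussianReal 0 v) P) (hind : IndepFun X ε P) :
    MemLp X (4 : ℕ) P ∧ ∫ ω, X ω ∂P = 0 ∧ ∫ ω, X ω ^ 2 ∂P = v - s ∧ ∫ ω, X ω ^ 3 ∂P = 0 ∧
      ∫ ω, X ω ^ 4 ∂P = 3 * ((v : ℝ) - s) ^ 2 := by
  have hmε := memLp_of_hasLaw_gaussianReal hε 4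
  have hmX : MemLp X (4 : ℕ) P := by
    refine ((memLp_of_hasLaw_gaussianReal hXε 4).sub hmε).ae_eq
      (Filter.Eventually.of_forall fun ω => ?_)
    simp
  -- This triangular system determines the moments of `X` one after the other, so Gaussianity of `X`
  -- itself need not be proved.
  have key : ∀ k ≤ 4, ∫ x, x ^ k ∂gaussianReal 0 v = ∑ j ∈ Finset.range (k + 1),
      (∫ ω, X ω ^ j ∂P) * (∫ x, x ^ (k - j) ∂gaussianReal 0 s) * (k.choose j : ℝ) := by
    intro k hk
    rw [← integral_pow_of_hasLaw hXε, integral_add_pow_of_indepFun hmX hmε hind hk]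
    simp only [integral_pow_of_hasLaw hε]
  have e1 : ∫ ω, X ω ∂P = 0 := by
    have h := key 1 (by norm_num)
    simp [Finset.sum_range_succ] at h
    exact h.symm
  have e2 : ∫ ω, X ω ^ 2 ∂P = v - s := by
    have h := key 2 (by norm_num)
    simp [Finset.sum_range_succ, e1, integral_sq_gaussianReal] at h
    linarith
  have e3 : ∫ ω, X ω ^ 3 ∂P = 0 := by
    have h := key 3 (by norm_num)
    simp [Finset.sum_range_succ, e1, integral_cube_gaussianReal] at h
    exact h.symm
  refine ⟨hmX, e1, e2, e3, ?_⟩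
  have h := key 4 le_rfl
  norm_num [Finset.sum_range_succ, e1, e2, e3, integral_sq_gaussianReal,
    integral_pow_four_gaussianReal, integral_cube_gaussianReal, Nat.choose] at h
  linarith

/-- The fourth moment bound for the logarithm of `∑ⱼ exp (-(X + εⱼ))`, around a constant which does
not depend on `X`. -/
lemma fourth_moment_logSumExpNeg_sub_le {ι : Type*} [Fintype ι] [Nonempty ι] {X : Ω → ℝ}
    {ε : ι → Ω → ℝ} {s v : NNReal}
    (hε : ∀ j, HasLaw (ε j) (gaussianReal 0 s) P) (hind : iIndepFun ε P)
    (hXε : ∀ j, HasLaw (fun ω => X ω + ε j ω) (gaussianReal 0 v) P)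
    (hX : IndepFun (fun ω j => ε j ω) X P) :
    Integrable (fun ω => (logSumExpNeg (fun j => ε j ω) - X ω - logSumExpMean ι s) ^ 4) P ∧
    ∫ ω, (logSumExpNeg (fun j => ε j ω) - X ω - logSumExpMean ι s) ^ 4 ∂P ≤ 16 * (v : ℝ) ^ 2 := by
  have hc := continuous_logSumExpNeg (ι := ι)
  have hlaw := hasLaw_pi_of_iIndepFun hε hind
  obtain ⟨j⟩ := ‹Nonempty ι›
  have : Nonempty ι := ⟨j⟩
  obtain ⟨hmX, e1, e2, e3, e4⟩ := moments_of_add_gaussian (hε j) (hXε j)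
    (hX.comp (measurable_pi_apply j) measurable_id).symm
  set Y : Ω → ℝ := fun ω => logSumExpNeg (fun j => ε j ω) - logSumExpMean ι s with hY
  have hmY : MemLp Y (4 : ℕ) P := by
    have h := memLp_logSumExpNeg_sub (ι := ι) s 4
    rw [← hlaw.map_eq] at h
    exact (memLp_map_measure_iff (by fun_prop) hlaw.aemeasurable).1 h
  have hYm : ∀ k : ℕ, ∫ ω, Y ω ^ k ∂P = ∫ x : ι → ℝ, (logSumExpNeg x - logSumExpMean ι s) ^ k
      ∂Measure.pi (fun _ : ι => gaussianReal 0 s) := fun k =>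
    hlaw.integral_comp (f := fun x => (logSumExpNeg x - logSumExpMean ι s) ^ k) (by fun_prop)
  have hXY : IndepFun Y (fun ω => -X ω) P :=
    hX.comp (φ := fun x => logSumExpNeg x - logSumExpMean ι s) (ψ := fun x => -x)
      (by fun_prop) measurable_neg
  have hfun : ∀ ω, logSumExpNeg (fun j => ε j ω) - X ω - logSumExpMean ι s = Y ω + -X ω :=
    fun ω => by simp only [hY]; ring
  simp only [hfun]
  have hmX' : MemLp (fun ω => -X ω) (4 : ℕ) P := hmX.neg
  refine ⟨integrable_pow_of_memLp (hmY.add hmX') le_rfl, ?_⟩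
  rw [integral_add_pow_of_indepFun hmY hmX' hXY le_rfl]
  have hn2 : ∫ ω, (-X ω) ^ 2 ∂P = v - s := by simpa using e2
  have hn3 : ∫ ω, (-X ω) ^ 3 ∂P = 0 := by
    have h : ∀ ω, (-X ω) ^ 3 = -X ω ^ 3 := fun ω => by ring
    simp only [h, integral_neg, e3, neg_zero]
  have hn4 : ∫ ω, (-X ω) ^ 4 ∂P = 3 * ((v : ℝ) - s) ^ 2 := by
    rw [← e4]; exact integral_congr_ae (Filter.Eventually.of_forall fun ω => by simp only; ring)
  have hy1 : ∫ ω, Y ω ∂P = 0 := by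
    simpa [integral_logSumExpNeg_sub] using hYm 1
  have hy2 := (hYm 2).trans_le (integral_logSumExpNeg_sub_mean_sq_le (ι := ι) s)
  have hy4 := (hYm 4).trans_le (integral_logSumExpNeg_sub_mean_pow_four_le (ι := ι) s)
  -- The difference is the second moment of `X`. The expansion is then at most `75/8 s² + 15/2 s (v
  -- - s) + 3 (v - s)²`, which is below `16 (s + (v - s))²`.
  have hvs : 0 ≤ (v : ℝ) - s := e2 ▸ integral_nonneg fun ω => sq_nonneg _
  norm_num [Finset.sum_range_succ, hn2, hn3, hn4, hy1, e1, integral_neg, Nat.choose]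
  nlinarith [mul_le_mul_of_nonneg_right hy2 hvs, s.coe_nonneg, mul_nonneg hvs s.coe_nonneg,
    sq_nonneg ((v : ℝ) - s), sq_nonneg (s : ℝ)]

end SeparableState

/-! ### Separable landscapes on regular graphs -/

section Landscape

variable {V Ω : Type*} [Fintype V] [DecidableEq V] [MeasurableSpace Ω] {P : Measure Ω}
  {G : SimpleGraph V} [DecidableRel G.Adj] {d : ℕ} {σW σB : ℝ}
  {W : V → Ω → ℝ} {B : V → V → Ω → ℝ}

/-- In a separable landscape on a regular graph, the differences between the log exit rates and the
well depths are concentrated around a common constant. -/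
lemma exists_fourth_moment_logExitRate_sub_le [IsProbabilityMeasure P] (hd : 0 < d)
    (hreg : G.IsRegularOfDegree d)
    (hL : IsDisorderedLandscape P G σW σB W B) (hS : IsSeparable P G W B) :
    ∃ c : ℝ, ∀ i,
      Integrable (fun ω =>
        (logExitRate (arr G (fun k => W k ω) (fun k l => B k l ω)) i - W i ω - c) ^ 4) P ∧
      ∫ ω, (logExitRate (arr G (fun k => W k ω) (fun k l => B k l ω)) i - W i ω - c) ^ 4 ∂P
        ≤ 16 * (σB ^ 2) ^ 2 := by
  obtain ⟨f, hf, σ, -, h⟩ := hS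
  have : Nonempty (Fin d) := ⟨⟨0, hd⟩⟩
  -- Indexing all neighbourhoods by `Fin d` makes the centering constant the same for every vertex;
  -- this is the use of regularity.
  refine ⟨logSumExpMean (Fin d) (Real.toNNReal (σ ^ 2)), fun i => ?_⟩
  obtain ⟨hlaw, hind, hindW⟩ := h i
  have hcard : Fintype.card (G.neighborSet i) = d := by
    rw [SimpleGraph.card_neighborSet_eq_degree, hreg i]
  let e : Fin d ≃ G.neighborSet i := (Fintype.equivFinOfCardEq hcard).symm
  have hne : (G.neighborFinset i).Nonempty := by
    rw [← Finset.card_pos, SimpleGraph.card_neighborFinset_eq_degree, hreg i]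
    exact hd
  have key := fourth_moment_logSumExpNeg_sub_le (X := fun ω => f (W i ω))
    (ε := fun k ω => B i (e k) ω - f (W i ω)) (v := Real.toNNReal (σB ^ 2))
    (fun k => hlaw (e k)) (hind.precomp e.injective)
    (fun k => by simpa using hL.barrier_law i (e k) (e k).2)
    (hindW.comp (φ := fun (x : G.neighborSet i → ℝ) (k : Fin d) => x (e k))
      (measurable_pi_lambda _ fun k => measurable_pi_apply _) hf)
  have hfun : ∀ ω, logExitRate (arr G (fun k => W k ω) (fun k l => B k l ω)) i - W i ω
      = logSumExpNeg (fun k => B i (e k) ω - f (W i ω)) - f (W i ω) := by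
    intro ω
    have hpos := sum_exp_neg_pos fun k => B i (e k) ω - f (W i ω)
    have hsum : ∑ k ∈ G.neighborFinset i, Real.exp (-B i k ω)
        = Real.exp (-f (W i ω)) * ∑ k, Real.exp (-(B i (e k) ω - f (W i ω))) := by
      rw [Finset.mul_sum, Finset.sum_subtype (p := fun k => k ∈ G.neighborSet i) _
        (fun k => by simp), ← e.sum_comp]
      refine Finset.sum_congr rfl fun k _ => ?_
      rw [← Real.exp_add]
      congr 1
      ring
    rw [logExitRate_arr hne, hsum, Real.log_mul (Real.exp_ne_zero _) hpos.ne', Real.log_exp,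
      logSumExpNeg]
    ring
  rw [Real.coe_toNNReal _ (sq_nonneg σB)] at key
  simpa only [hfun] using key

lemma measurable_unifCorr {V : Type*} [Fintype V] :
    Measurable fun z : (V → ℝ) × (V → ℝ) => unifCorr z.1 z.2 := by
  unfold unifCorr unifVar unifCov unifMean
  fun_prop

lemma aemeasurable_logExitRate (hn : ∀ i, (G.neighborFinset i).Nonempty)
    (hL : IsDisorderedLandscape P G σW σB W B) :
    AEMeasurable (fun ω => logExitRate (arr G (fun k => W k ω) (fun k l => B k l ω))) P := by
  refine aemeasurable_pi_lambda _ fun i => ?_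
  simp only [logExitRate_arr (hn _)]
  refine (hL.well_law i).aemeasurable.add (Finset.aemeasurable_fun_sum _ fun k hk => ?_).log
  exact (hL.barrier_law i k ((G.mem_neighborFinset i k).1 hk)).aemeasurable.neg.exp

/-- Source of the constant 10: the left side is at most `1 + 100 / n`, which is below the square on
the right. -/
lemma sq_div_le_one_add_rpow_sq {n : ℝ} (hn : 6 ≤ n) :
    n ^ 2 / ((n - 5) * (n - 3)) ≤ (1 + 10 * n ^ (-(1 / 2) : ℝ)) ^ 2 := by
  have hn0 : 0 < n := by linarith
  have h0 : 0 ≤ n ^ (-(1 / 2) : ℝ) := Real.rpow_nonneg hn0.le _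
  have h2 : (n ^ (-(1 / 2) : ℝ)) ^ 2 = n⁻¹ := by
    rw [← Real.rpow_natCast, ← Real.rpow_mul hn0.le, ← Real.rpow_neg_one]
    norm_num
  have h3 : n ^ 2 / ((n - 5) * (n - 3)) ≤ 1 + 100 * n⁻¹ := by
    rw [div_le_iff₀ (mul_pos (by linarith) (by linarith))]
    have : (1 + 100 * n⁻¹) * ((n - 5) * (n - 3)) = (n + 100) * ((n - 5) * (n - 3)) / n := by
      field_simp
    rw [this, le_div_iff₀ hn0]
    nlinarith [mul_nonneg (sub_nonneg.2 hn) (sub_nonneg.2 hn)]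
  nlinarith

end Landscape

end Arrhenius

/-! ### The correlation bound -/

theorem theorem1 :
    ∃ C : ℝ, ∀ (V : Type*) [Fintype V] [DecidableEq V] (G : SimpleGraph V) [DecidableRel G.Adj]
      (d : ℕ) (Ω : Type*) [MeasurableSpace Ω] (P : Measure Ω) [IsProbabilityMeasure P]
      (σW σB : ℝ) (W : V → Ω → ℝ) (B : V → V → Ω → ℝ),
      G.Connected → G.IsRegularOfDegree d → 6 ≤ Fintype.card V → 0 < σW → 0 < σB →
      Arrhenius.IsDisorderedLandscape P G σW σB W B → Arrhenius.IsSeparable P G W B →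
      (∀ᵐ ω ∂P, ∃ i j,
        Arrhenius.exitRate (Arrhenius.arr G (fun k => W k ω) (fun k l => B k l ω)) i ≠
          Arrhenius.exitRate (Arrhenius.arr G (fun k => W k ω) (fun k l => B k l ω)) j) →
      (∀ᵐ ω ∂P,
        Arrhenius.RhoWellDefined (Arrhenius.arr G (fun k => W k ω) (fun k l => B k l ω))) ∧
      Integrable
        (fun ω => Arrhenius.rho (Arrhenius.arr G (fun k => W k ω) (fun k l => B k l ω))) P ∧
      1 - 8 * (1 + C * (Fintype.card V : ℝ) ^ (-(1 / 2) : ℝ)) * (σB / σW) ^ 2 ≤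
        ∫ ω, Arrhenius.rho (Arrhenius.arr G (fun k => W k ω) (fun k l => B k l ω)) ∂P := by

  refine ⟨10, ?_⟩
  intro V _ _ G _ d Ω _ P _ σW σB W B hG hreg hV hσW hσB hL hS hq
  have hVne : Nonempty V := hG.nonempty
  have hnt : Nontrivial V := Fintype.one_lt_card_iff_nontrivial.1 (by omega)
  have hd : 0 < d := by
    obtain ⟨i⟩ := hVne
    rw [← hreg i]
    exact hG.preconnected.degree_pos_of_nontrivial i
  have hn : ∀ i, (G.neighborFinset i).Nonempty := fun i => by
    rw [← Finset.card_pos, SimpleGraph.card_neighborFinset_eq_degree, hreg i]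
    exact hd
  have hb : ∀ᵐ ω ∂P, ∀ i j, G.Adj i j → B i j ω = B j i ω := by
    simp only [ae_all_iff]
    exact fun i j hij => hL.barrier_symm i j hij
  have hv : Real.toNNReal (σW ^ 2) ≠ 0 := (Real.toNNReal_pos.2 (by positivity)).ne'
  obtain ⟨hWpos, hWint, hWle⟩ :=
    Arrhenius.unifVar_inv_sq_of_gaussian hv hV hL.well_law hL.well_indep
  rw [Real.coe_toNNReal _ (sq_nonneg σW)] at hWle
  have hwd : ∀ᵐ ω ∂P,
      Arrhenius.RhoWellDefined (Arrhenius.arr G (fun k => W k ω) (fun k l => B k l ω)) := by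
    filter_upwards [hb, hWpos, hq] with ω h1 h2 h3
    exact Arrhenius.rhoWellDefined_arr hG h1 hn h2 h3
  have hmeas : AEStronglyMeasurable
      (fun ω => Arrhenius.rho (Arrhenius.arr G (fun k => W k ω) (fun k l => B k l ω))) P := by
    -- The stationary distribution is defined by choice, so measurability is obtained from the
    -- explicit formula with which `rho` agrees almost surely.
    have hm := Arrhenius.measurable_unifCorr.comp_aemeasurable
      ((aemeasurable_pi_lambda (fun ω k => W k ω) fun i => (hL.well_law i).aemeasurable).prodMk
        (Arrhenius.aemeasurable_logExitRate hn hL))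
    refine (hm.congr ?_).aestronglyMeasurable
    filter_upwards [hb] with ω h1
    exact (Arrhenius.rho_arr hG h1).symm
  have hint : Integrable
      (fun ω => Arrhenius.rho (Arrhenius.arr G (fun k => W k ω) (fun k l => B k l ω))) P :=
    Integrable.of_bound hmeas 1
      (Filter.Eventually.of_forall fun ω => Arrhenius.abs_unifCorr_le_one _ _)
  refine ⟨hwd, hint, ?_⟩
  obtain ⟨c, hc⟩ := Arrhenius.exists_fourth_moment_logExitRate_sub_le hd hreg hL hS
  set D : V → Ω → ℝ := fun i ω => Arrhenius.logExitRate
    (Arrhenius.arr G (fun k => W k ω) (fun k l => B k l ω)) i - W i ω with hD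
  set n : ℝ := (Fintype.card V : ℝ) with hn_def
  have hn6 : (6 : ℝ) ≤ n := by rw [hn_def]; exact_mod_cast hV
  have hn0 : 0 < n := by linarith
  set κ : ℝ := 1 + 10 * n ^ (-(1 / 2) : ℝ) with hκ
  have hκ0 : 0 < κ := by
    have := Real.rpow_nonneg hn0.le (-(1 / 2) : ℝ)
    positivity
  have hκ2 : n ^ 2 / ((n - 5) * (n - 3)) ≤ κ ^ 2 := Arrhenius.sq_div_le_one_add_rpow_sq hn6
  have hTint : Integrable (fun ω => Arrhenius.unifMean fun i => (D i ω - c) ^ 4) P :=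
    (integrable_finsetSum _ fun i _ => (hc i).1).div_const _
  have hTle : ∫ ω, (Arrhenius.unifMean fun i => (D i ω - c) ^ 4) ∂P ≤ 16 * (σB ^ 2) ^ 2 := by
    simp only [Arrhenius.unifMean]
    rw [integral_div, integral_finsetSum _ fun i _ => (hc i).1, div_le_iff₀ hn0]
    refine (Finset.sum_le_sum fun i _ => (hc i).2).trans_eq ?_
    rw [Finset.sum_const, Finset.card_univ, nsmul_eq_mul, mul_comm]
  -- The optimal AM-GM weight for the bounds `16 σB⁴` and `κ² / σW⁴`: both terms become `4 κ (σB /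
  -- σW)²`, as Cauchy-Schwarz would give.
  set l : ℝ := κ / (4 * σB ^ 2 * σW ^ 2) with hl
  have hl0 : 0 < l := by positivity
  have hpt : ∀ᵐ ω ∂P,
      1 - Arrhenius.rho (Arrhenius.arr G (fun k => W k ω) (fun k l => B k l ω))
        ≤ l * (Arrhenius.unifMean fun i => (D i ω - c) ^ 4)
          + l⁻¹ * (Arrhenius.unifVar fun i => W i ω)⁻¹ ^ 2 := by
    filter_upwards [hb, hWpos, hwd] with ω h1 h2 h3
    rw [Arrhenius.rho_arr hG h1]
    refine (Arrhenius.one_sub_unifCorr_le h2 h3.logExitRate_var_pos).trans ?_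
    -- The variance is at most the mean square deviation from the deterministic `c`; squaring and
    -- Jensen give fourth powers.
    have h4 : (Arrhenius.unifVar fun i => D i ω) ^ 2
        ≤ Arrhenius.unifMean fun i => (D i ω - c) ^ 4 := by
      refine (pow_le_pow_left₀ (Arrhenius.unifVar_nonneg _)
        (Arrhenius.unifVar_le_unifMean_sub_sq _ c) 2).trans ?_
      refine (Arrhenius.unifMean_sq_le _).trans_eq ?_
      simp only [← pow_mul]
    rw [div_eq_mul_inv]
    set a := Arrhenius.unifVar fun i => D i ω
    set b := (Arrhenius.unifVar fun i => W i ω)⁻¹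
    have h5 : 2 * (a * b) ≤ l * a ^ 2 + l⁻¹ * b ^ 2 := by
      have h6 : l * a ^ 2 + l⁻¹ * b ^ 2 - 2 * (a * b) = l * (a - l⁻¹ * b) ^ 2 := by
        field_simp
        ring
      have h7 : 0 ≤ l * (a - l⁻¹ * b) ^ 2 := by positivity
      linarith
    exact h5.trans (by gcongr)
  have hmain := integral_mono_ae ((integrable_const (1 : ℝ)).sub hint)
    ((hTint.const_mul l).add (hWint.const_mul l⁻¹)) hpt
  simp only [Pi.sub_apply, Pi.add_apply] at hmain
  rw [integral_sub (integrable_const _) hint, integral_add (hTint.const_mul l)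
    (hWint.const_mul l⁻¹), integral_const_mul, integral_const_mul] at hmain
  simp only [integral_const, probReal_univ, smul_eq_mul, mul_one] at hmain
  have hW2 : ∫ ω, (Arrhenius.unifVar fun i => W i ω)⁻¹ ^ 2 ∂P ≤ κ ^ 2 / (σW ^ 2) ^ 2 := by
    refine hWle.trans ?_
    rw [mul_comm ((σW ^ 2) ^ 2), ← div_div]
    gcongr
  have hfin : l * (16 * (σB ^ 2) ^ 2) + l⁻¹ * (κ ^ 2 / (σW ^ 2) ^ 2)
      = 8 * κ * (σB / σW) ^ 2 := by
    rw [hl]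
    field_simp
    ring
  have h8 := mul_le_mul_of_nonneg_left hTle hl0.le
  have h9 := mul_le_mul_of_nonneg_left hW2 (inv_pos.2 hl0).le
  linarith
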